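/- Let $m\ge 2$, $n\ge 1$, and let $\mathcal A=(a_{i_1\dots i_m})$ be a real symmetric tensor of order $m$ and dimension $n$ that is nonzero, entrywise nonnegative and irreducible; the latter means that there is no nonempty proper subset $I\subset\{1,\dots,n\}$ with $a_{ii_2\dots i_m}=0$ for all $i\in I$ and all $i_2,\dots,i_m\notin I$. For $x\in\mathbb R^n$ put $$(\mathcal Ax^{m-1})_i=\sum_{i_2,\dots,i_m}a_{ii_2\dots i_m}x_{i_2}\cdots x_{i_m},\qquad (\mathcal Ax^{m-2})_{ij}=\sum_{i_3,\dots,i_m}a_{iji_3\dots i_m}x_{i_3}\cdots x_{i_m},\qquad \mathcal Ax^m=x^T\mathcal Ax^{m-1},$$ and let $x^{[r]}$ denote the entrywise power, $\circ$ the entrywise product and $\mathcal Ax^{m-1}/x$ the entrywise quotient. A real $\lambda$ is an H-eigenvalue with H-eigenvector $x\in\mathbb R^n$ if $\mathcal Ax^{m-1}=\lambda x^{[m-1]}$ and $\sum_{i=1}^n x_i^m=1$, and $\rho(\mathcal A)$ is the maximum of $|\lambda|$ over all H-eigenvalues. There is exactly one pair $(\bar x,\bar\lambda)$ such that $\bar\lambda=\rho(\mathcal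 A)$ is an H-eigenvalue with an entrywise positive H-eigenvector $\bar x$; call it the Perron pair. Let $$\overline T=-\frac1m\,\bar\lambda^{-1}\,\mathrm{diag}\big(\bar x^{[-\frac{m-2}2]}\big)\,B(\bar x)\,\mathrm{diag}\big(\bar x^{[-\frac{m-2}2]}\big),$$ $$B(x)=\frac m{\mathcal Ax^m}(\mathcal Ax^{m-1})(\mathcal Ax^{m-1})^T-(m-1)\mathcal Ax^{m-2}-\mathrm{diag}\Big(\frac{\mathcal Ax^{m-1}}{x}\Big).$$ Let $x_0\in\mathbb R^n$ be any entrywise positive vector with $\sum_i (x_0)_i^m=1$, and let the power-like method produce, as long as $\mathcal Ax_k^{m-1}\ne(\mathcal Ax_k^m)\,x_k^{[m-1]}$, $$x_{k+1}=\Big(\frac{\mathcal Ax_k^{m-1}\circ x_k}{\mathcal Ax_k^m}\Big)^{[1/m]};$$ if the method stops at some $k$, put $x_j=x_k$ for all $j>k$. Let $\lambda_k=\mathcal Ax_k^m$ for all $k\ge0$. Then: (i) The spectral radius of the matrix $\overline T$ is less than $1$. (ii) The sequence $(x_k)$ converges Q-linearly to $\bar x$ in the norm $\|p\|_{\bar x}=\big(p^T\mathrm{diag}(\bar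 x^{[m-2]})p\big)^{1/2}$: $\|x_k-\bar x\|_{\bar x}\to0$, and there is $\delta\in(0,1)$ with $\|x_{k+1}-\bar x\|_{\bar x}\le\delta\|x_k-\bar x\|_{\bar x}$ for all sufficiently large $k$. (iii) The sequence $(\lambda_k)$ converges Q-linearly to $\bar\lambda$: $\lambda_k\to\bar\lambda$, and there is $\delta'\in(0,1)$ with $|\lambda_{k+1}-\bar\lambda|\le\delta'|\lambda_k-\bar\lambda|$ for all sufficiently large $k$. -/

import Mathlib

/-!
Real tensors of order `m` and dimension `n`.  From the eigenvalue notions on, the order is written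
`m = d + 2`, so that `m - 1 = d + 1` and `m - 2 = d` (this is the same as `2 ≤ m`).
-/

open Filter Topology

noncomputable section

namespace PowerLike

/-- Real tensors of order `m` and dimension `n`: the entry `a_{i_1 … i_m}` is `A ![i_1, …, i_m]`. -/
abbrev Tensor (m n : ℕ) : Type := (Fin m → Fin n) → ℝ

namespace Tensor

variable {m n d : ℕ}

/-- The entries are invariant under every permutation of the indices. -/
def IsSymmetric (A : Tensor m n) : Prop :=
  ∀ (σ : Equiv.Perm (Fin m)) (I : Fin m → Fin n), A (fun j => I (σ j)) = A I

/-- All entries are nonnegative. -/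
def IsNonneg (A : Tensor m n) : Prop := ∀ I, 0 ≤ A I

/-- There is a nonempty proper index set `S` with `a_{i i_2 … i_m} = 0` for all `i ∈ S` and all
`i_2, …, i_m ∉ S`. -/
def IsReducible (A : Tensor (d + 1) n) : Prop :=
  ∃ S : Set (Fin n), S.Nonempty ∧ S ≠ Set.univ ∧
    ∀ i ∈ S, ∀ J : Fin d → Fin n, (∀ j, J j ∉ S) → A (Matrix.vecCons i J) = 0

/-- Not reducible. -/
def IsIrreducible (A : Tensor (d + 1) n) : Prop := ¬ A.IsReducible

/-- The scalar `A x^m`. -/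
def form (A : Tensor m n) (x : Fin n → ℝ) : ℝ :=
  ∑ I : Fin m → Fin n, A I * ∏ j, x (I j)

/-- The vector `A x^(m-1)`, for a tensor of order `m = d + 1`. -/
def contractVec (A : Tensor (d + 1) n) (x : Fin n → ℝ) : Fin n → ℝ :=
  fun i => ∑ J : Fin d → Fin n, A (Matrix.vecCons i J) * ∏ l, x (J l)

/-- The matrix `A x^(m-2)`, for a tensor of order `m = d + 2`. -/
def contractMat (A : Tensor (d + 2) n) (x : Fin n → ℝ) : Matrix (Fin n) (Fin n) ℝ :=
  Matrix.of fun i j =>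
    ∑ J : Fin d → Fin n, A (Matrix.vecCons i (Matrix.vecCons j J)) * ∏ l, x (J l)

/-- `lam` is an H-eigenvalue of `A` with H-eigenvector `x`:
`A x^(m-1) = lam x^[m-1]` and `∑ x_i^m = 1`. -/
def IsHEigenpair (A : Tensor (d + 2) n) (lam : ℝ) (x : Fin n → ℝ) : Prop :=
  (∀ i, A.contractVec x i = lam * x i ^ (d + 1)) ∧ ∑ i, x i ^ (d + 2) = 1

/-- `r` is the spectral radius of `A`, the maximum modulus of the H-eigenvalues. -/
def IsSpectralRadius (A : Tensor (d + 2) n) (r : ℝ) : Prop :=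
  IsGreatest {s : ℝ | ∃ lam x, A.IsHEigenpair lam x ∧ s = |lam|} r

/-- The Perron pair: the spectral radius `lam` together with a positive (normalized) H-eigenvector
`x` for the H-eigenvalue `lam`. -/
def IsPerronPair (A : Tensor (d + 2) n) (x : Fin n → ℝ) (lam : ℝ) : Prop :=
  A.IsSpectralRadius lam ∧ A.IsHEigenpair lam x ∧ ∀ i, 0 < x i

/-- The residual `F(x) = -A x^(m-1) + (A x^m) x^[m-1]`. -/
def residual (A : Tensor (d + 2) n) (x : Fin n → ℝ) : Fin n → ℝ :=
  fun i => -A.contractVec x i + A.form x * x i ^ (d + 1)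

/-- One step of the power-like method, `((A x^(m-1) ∘ x) / (A x^m))^[1/m]`. -/
def powerStep (A : Tensor (d + 2) n) (x : Fin n → ℝ) : Fin n → ℝ :=
  fun i => (A.contractVec x i * x i / A.form x) ^ (1 / ((d + 2 : ℕ) : ℝ))

open Classical in
/-- The iterates `x_k` of the power-like method started at `x₀`.  The method stops as soon as
`F(x_k) = 0`; the sequence is then continued by its last term. -/
def powerSeq (A : Tensor (d + 2) n) (x₀ : Fin n → ℝ) : ℕ → Fin n → ℝ
  | 0 => x₀
  | k + 1 =>
    if A.residual (A.powerSeq x₀ k) = 0 then A.powerSeq x₀ k else A.powerStep (A.powerSeq x₀ k)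

/-- The eigenvalue estimates `lam_k = A x_k^m`. -/
def powerEig (A : Tensor (d + 2) n) (x₀ : Fin n → ℝ) (k : ℕ) : ℝ := A.form (A.powerSeq x₀ k)

/-- `B(x) = (m / A x^m) (A x^(m-1)) (A x^(m-1))ᵀ - (m-1) A x^(m-2) - diag (A x^(m-1) / x)`. -/
def matB (A : Tensor (d + 2) n) (x : Fin n → ℝ) : Matrix (Fin n) (Fin n) ℝ :=
  (((d + 2 : ℕ) : ℝ) / A.form x) • Matrix.vecMulVec (A.contractVec x) (A.contractVec x)
    - ((d + 1 : ℕ) : ℝ) • A.contractMat x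
    - Matrix.diagonal (fun i => A.contractVec x i / x i)

/-- The matrix `T = -(1/m) lam⁻¹ diag (x^[-(m-2)/2]) B(x) diag (x^[-(m-2)/2])`. -/
def iterMat (A : Tensor (d + 2) n) (x : Fin n → ℝ) (lam : ℝ) : Matrix (Fin n) (Fin n) ℝ :=
  (-(1 / ((d + 2 : ℕ) : ℝ)) * lam⁻¹) •
    (Matrix.diagonal (fun i => x i ^ (-(d : ℝ) / 2)) * A.matB x *
      Matrix.diagonal (fun i => x i ^ (-(d : ℝ) / 2)))

end Tensor

/-- The set `𝔹₊` of positive vectors with `∑ x_i^m = 1`. -/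
def posSphere (m n : ℕ) : Set (Fin n → ℝ) := {x | (∀ i, 0 < x i) ∧ ∑ i, x i ^ m = 1}

/-- The weighted norm `‖p‖_x = (pᵀ diag (x^[e]) p)^(1/2)`; it is used with `e = m - 2`. -/
def weightedNorm {n : ℕ} (e : ℕ) (x p : Fin n → ℝ) : ℝ :=
  Real.sqrt (p ⬝ᵥ (Matrix.diagonal (fun i => x i ^ e)).mulVec p)

/-- A sequence with error terms `err k` converges Q-linearly: the errors tend to zero, and for some
`δ ∈ (0, 1)` one has `err (k + 1) ≤ δ * err k` for all sufficiently large `k`. -/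
def QLinear (err : ℕ → ℝ) : Prop :=
  Tendsto err atTop (𝓝 0) ∧ ∃ δ ∈ Set.Ioo (0 : ℝ) 1, ∀ᶠ k in atTop, err (k + 1) ≤ δ * err k

end PowerLike

end

/-! Let w = x̄^[m] be the probability vector attached to a positive eigenvector x̄, and write G for
one step of the method. Comparing with x̄ through the ratios y/x̄ turns the form into a weighted sum
of products. AM-GM then gives A y^m ≤ λ̄ Σ y_i^m for nonnegative y, with equality among positive
normalized vectors only at x̄, by irreducibility. Together with maximization over the nonnegative
part of the unit sphere, this yields the Perron pair. The linearization of G at x̄ is, in the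
coordinates r = v/x̄, the map r ↦ K r - (w·r) 1. Here K = (I + (m-1)P)/m is a lazy Markov kernel,
reversible with respect to w (`exists_hasFDerivAt_powerStep`). Variance decomposition and
connectedness make this map a strict contraction of L²(w) (`exists_kernel_contraction`). T̄ is
similar to it by a diagonal matrix that turns the L²(w) norm into the Euclidean one, hence (i).
Since ‖v‖_x̄ is the L²(w) norm of r, G contracts near x̄ in exactly the norm of (ii). Global
convergence uses the Lyapunov function V(y) = Σ w_i log y_i. Jensen's inequality for log gives m(V(G
y) - V(y)) ≥ log λ̄ - log A y^m ≥ 0 (`sum_log_powerStep`). As V ≤ 0, the right side tends to zero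
along the orbit; V being bounded below there keeps the orbit away from the boundary. For (iii), the
same Jensen inequality bounds the increment λ_{k+1} - λ_k below by a Kullback–Leibler divergence,
and the gap λ̄ - λ_k above by a chi-square distance. By (ii) both compare with ‖x_k - x̄‖², so the
gap is at most a constant times the increment. -/

noncomputable section

/-! ### Symmetric forms: polarization, Euler identity, derivative. -/

namespace PowerLike.Tensor

variable {k d n : ℕ}

/-- The tensor of order `k` obtained by fixing the first index. -/
def slice (A : Tensor (k + 1) n) (i : Fin n) : Tensor k n := fun J => A (Matrix.vecCons i J)

lemma contractVec_eq_form_slice (A : Tensor (k + 1) n) (x : Fin n → ℝ) (i : Fin n) :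
    A.contractVec x i = (A.slice i).form x := rfl

lemma contractMat_eq_contractVec_slice (A : Tensor (k + 2) n) (x : Fin n → ℝ) (i j : Fin n) :
    A.contractMat x i j = (A.slice i).contractVec x j := rfl

lemma IsSymmetric.slice {A : Tensor (k + 1) n} (hA : A.IsSymmetric) (i : Fin n) :
    (A.slice i).IsSymmetric := by
  intro σ J
  have h := hA (Equiv.Perm.decomposeFin.symm (0, σ)) (Matrix.vecCons i J)
  rw [PowerLike.Tensor.slice, PowerLike.Tensor.slice, ← h]
  congr 1
  funext j
  refine Fin.cases ?_ (fun j => ?_) j <;> simp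

lemma IsNonneg.slice {A : Tensor (k + 1) n} (hA : A.IsNonneg) (i : Fin n) :
    (A.slice i).IsNonneg := fun _ => hA _

/-- Lets any slot of a multi-index play the role of the first one; the permutation involved is a
cycle. -/
lemma IsSymmetric.insertNth {A : Tensor (k + 1) n} (hA : A.IsSymmetric) (l : Fin (k + 1))
    (j : Fin n) (J : Fin k → Fin n) :
    A (Fin.insertNth (α := fun _ => Fin n) l j J) = A (Matrix.vecCons j J) := by
  have h := hA l.cycleRange.symm (Fin.insertNth (α := fun _ => Fin n) l j J)
  rw [← h]
  congr 1
  exact Fin.insertNth_comp_cycleRange_symm l j J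

lemma IsSymmetric.contractMat_comm {A : Tensor (k + 2) n} (hA : A.IsSymmetric)
    (x : Fin n → ℝ) (i j : Fin n) : A.contractMat x i j = A.contractMat x j i := by
  simp only [contractMat, Matrix.of_apply]
  refine Finset.sum_congr rfl fun J _ => ?_
  congr 1
  have h := hA (Equiv.swap 0 1) (Matrix.vecCons i (Matrix.vecCons j J))
  rw [← h]
  congr 1
  funext t
  refine Fin.cases ?_ (fun t => Fin.cases ?_ (fun t => ?_) t) t
  · simp
  · simp
  · rw [Equiv.swap_apply_of_ne_of_ne]
    · simp
    · simp
    · simp [Fin.ext_iff]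

/-- The polarization of the form along a direction `v`. -/
lemma IsSymmetric.sum_polarize {A : Tensor (k + 1) n} (hA : A.IsSymmetric) (x v : Fin n → ℝ) :
    ∑ I, A I * ∑ l, v (I l) * ∏ t, x (I (l.succAbove t))
      = ((k + 1 : ℕ) : ℝ) * ∑ i, v i * A.contractVec x i := by
  simp_rw [Finset.mul_sum]
  rw [Finset.sum_comm]
  have key : ∀ l : Fin (k + 1),
      ∑ I, A I * (v (I l) * ∏ t, x (I (l.succAbove t))) = ∑ i, v i * A.contractVec x i := by
    intro l
    rw [← (Fin.insertNthEquiv (fun _ => Fin n) l).sum_comp, Fintype.sum_prod_type]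
    refine Finset.sum_congr rfl fun i _ => ?_
    rw [contractVec, Finset.mul_sum]
    refine Finset.sum_congr rfl fun J _ => ?_
    have h : A (Fin.insertNthEquiv (fun _ => Fin n) l (i, J)) = A (Matrix.vecCons i J) :=
      hA.insertNth l i J
    rw [h]
    simp only [Fin.insertNthEquiv_apply, Fin.insertNth_apply_same,
      Fin.insertNth_apply_succAbove]
    ring
  rw [Finset.sum_congr rfl fun l _ => key l]
  simp [Finset.mul_sum]

/-- Polarization in the direction v ∘ x. With the A_I ∏ x as weights, it evaluates the averages that
occur in AM-GM (v a power of a ratio) and in Jensen's inequality (v a logarithm). -/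
lemma IsSymmetric.sum_weighted {A : Tensor (k + 1) n} (hA : A.IsSymmetric) (x v : Fin n → ℝ) :
    ∑ I, A I * (∏ l, x (I l)) * ∑ l, v (I l)
      = ((k + 1 : ℕ) : ℝ) * ∑ i, v i * (x i * A.contractVec x i) := by
  have h := hA.sum_polarize x (fun i => v i * x i)
  simp only [mul_assoc] at h ⊢
  rw [← h]
  refine Finset.sum_congr rfl fun I _ => ?_
  congr 1
  rw [Finset.mul_sum]
  refine Finset.sum_congr rfl fun l _ => ?_
  rw [Fin.prod_univ_succAbove (fun l => x (I l)) l]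
  ring

lemma form_eq_sum (A : Tensor (k + 1) n) (x : Fin n → ℝ) :
    A.form x = ∑ i, x i * A.contractVec x i := by
  rw [form, ← (Fin.insertNthEquiv (fun _ => Fin n) 0).sum_comp, Fintype.sum_prod_type]
  refine Finset.sum_congr rfl fun i _ => ?_
  rw [contractVec, Finset.mul_sum]
  refine Finset.sum_congr rfl fun J _ => ?_
  have h : Fin.insertNthEquiv (fun _ => Fin n) 0 (i, J) = Matrix.vecCons i J :=
    Fin.insertNth_zero' i J
  rw [h, Fin.prod_univ_succ]
  simp only [Matrix.cons_val_zero, Matrix.cons_val_succ]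
  ring

lemma contractVec_eq_sum (A : Tensor (k + 2) n) (x : Fin n → ℝ) (i : Fin n) :
    A.contractVec x i = ∑ j, A.contractMat x i j * x j := by
  rw [contractVec_eq_form_slice, form_eq_sum]
  simp only [contractMat_eq_contractVec_slice, mul_comm]

lemma continuous_form (A : Tensor k n) : Continuous A.form := by
  unfold form; fun_prop

lemma form_smul (A : Tensor k n) (c : ℝ) (x : Fin n → ℝ) :
    A.form (c • x) = c ^ k * A.form x := by
  simp only [form, Pi.smul_apply, smul_eq_mul, Finset.prod_mul_distrib, Finset.prod_const,
    Finset.card_univ, Fintype.card_fin, Finset.mul_sum]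
  exact Finset.sum_congr rfl fun I _ => by ring

lemma IsNonneg.form_nonneg {A : Tensor k n} (hA : A.IsNonneg) {x : Fin n → ℝ}
    (hx : ∀ i, 0 ≤ x i) : 0 ≤ A.form x :=
  Finset.sum_nonneg fun I _ => mul_nonneg (hA I) (Finset.prod_nonneg fun _ _ => hx _)

lemma IsNonneg.form_pos {A : Tensor k n} (hA : A.IsNonneg) (h0 : A ≠ 0) {x : Fin n → ℝ}
    (hx : ∀ i, 0 < x i) : 0 < A.form x := by
  obtain ⟨I, hI⟩ := Function.ne_iff.mp h0
  refine Finset.sum_pos' (fun I _ => mul_nonneg (hA I) (Finset.prod_nonneg fun _ _ => (hx _).le))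
    ⟨I, Finset.mem_univ _, mul_pos ((hA I).lt_of_ne' hI) (Finset.prod_pos fun _ _ => hx _)⟩

lemma IsNonneg.contractVec_nonneg {A : Tensor (k + 1) n} (hA : A.IsNonneg) {x : Fin n → ℝ}
    (hx : ∀ i, 0 ≤ x i) (i : Fin n) : 0 ≤ A.contractVec x i :=
  (hA.slice i).form_nonneg hx

lemma IsNonneg.contractMat_nonneg {A : Tensor (k + 2) n} (hA : A.IsNonneg) {x : Fin n → ℝ}
    (hx : ∀ i, 0 ≤ x i) (i j : Fin n) : 0 ≤ A.contractMat x i j :=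
  (hA.slice i).contractVec_nonneg hx j

lemma IsSymmetric.hasFDerivAt_form {A : Tensor (k + 1) n} (hA : A.IsSymmetric) (x : Fin n → ℝ) :
    HasFDerivAt A.form (((k + 1 : ℕ) : ℝ) •
      ∑ i, A.contractVec x i • (ContinuousLinearMap.proj i : (Fin n → ℝ) →L[ℝ] ℝ)) x := by
  have h : HasFDerivAt A.form (∑ I : Fin (k + 1) → Fin n, A I • ∑ l : Fin (k + 1),
      (∏ t ∈ Finset.univ.erase l, x (I t)) •
        (ContinuousLinearMap.proj (I l) : (Fin n → ℝ) →L[ℝ] ℝ)) x := by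
    unfold form
    refine HasFDerivAt.fun_sum fun I _ => HasFDerivAt.const_mul ?_ _
    exact HasFDerivAt.finsetProd fun l _ => hasFDerivAt_apply (I l) x
  convert h using 1
  ext v
  have := hA.sum_polarize x v
  simp only [smul_apply, sum_apply,
    ContinuousLinearMap.proj_apply, smul_eq_mul]
  simp only [mul_comm (A.contractVec x _)]
  rw [← this]
  refine Finset.sum_congr rfl fun I _ => ?_
  congr 1
  refine Finset.sum_congr rfl fun l _ => ?_
  have he : Finset.univ.erase l = Finset.univ.image l.succAbove := by
    rw [Fin.image_succAbove_univ]; ext; simp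
  rw [he, Finset.prod_image (fun _ _ _ _ h => Fin.succAbove_right_injective h), mul_comm]

end PowerLike.Tensor

/-! ### AM-GM comparison with a positive eigenvector; the Perron pair. -/

namespace PowerLike.Tensor

variable {k d n : ℕ}

lemma prod_le_mean_pow (z : Fin (k + 1) → ℝ) (hz : ∀ l, 0 ≤ z l) :
    ∏ l, z l ≤ ((k + 1 : ℕ) : ℝ)⁻¹ * ∑ l, z l ^ (k + 1) := by
  have h := Real.geom_mean_le_arith_mean_weighted Finset.univ
    (fun _ => ((k + 1 : ℕ) : ℝ)⁻¹) (fun l => z l ^ (k + 1)) (fun _ _ => by positivity)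
    (by simp; field_simp) (fun l _ => pow_nonneg (hz l) _)
  rw [← Finset.mul_sum] at h
  refine le_trans (le_of_eq ?_) h
  exact Finset.prod_congr rfl fun l _ => (Real.pow_rpow_inv_natCast (hz l) (by omega)).symm

lemma eq_of_prod_eq_mean_pow (z : Fin (k + 1) → ℝ) (hz : ∀ l, 0 ≤ z l)
    (h : ∏ l, z l = ((k + 1 : ℕ) : ℝ)⁻¹ * ∑ l, z l ^ (k + 1)) (i j : Fin (k + 1)) :
    z i = z j := by
  have h' := (Real.geom_mean_eq_arith_mean_weighted_iff_of_pos Finset.univ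
    (fun _ => ((k + 1 : ℕ) : ℝ)⁻¹) (fun l => z l ^ (k + 1)) (fun _ _ => by positivity)
    (by simp; field_simp) (fun l _ => pow_nonneg (hz l) _)).mp (by
      rw [← Finset.mul_sum, ← h]
      exact Finset.prod_congr rfl fun l _ => (Real.pow_rpow_inv_natCast (hz l) (by omega)))
    i (Finset.mem_univ _) j (Finset.mem_univ _)
  exact (pow_left_inj₀ (hz i) (hz j) (by omega)).mp h'

/-- A function that is constant along the nonzero entries of an irreducible tensor is constant. -/
lemma IsIrreducible.eq_of_forall {A : Tensor (d + 2) n} (hA : A.IsIrreducible) {r : Fin n → ℝ}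
    (hr : ∀ i (J : Fin (d + 1) → Fin n), A (Matrix.vecCons i J) ≠ 0 → r (J 0) = r i)
    (i j : Fin n) : r i = r j := by
  by_contra hij
  refine hA ⟨{t | r t = r i}, ⟨i, rfl⟩, fun h => hij ?_, fun a ha J hJ => ?_⟩
  · have : j ∈ {t | r t = r i} := h ▸ Set.mem_univ j
    exact this.symm
  · by_contra hne
    exact hJ 0 ((hr a J hne).trans ha)

section Eigen

variable {A : Tensor (d + 2) n} {x y : Fin n → ℝ} {lam : ℝ}

lemma IsHEigenpair.form_eq (h : A.IsHEigenpair lam x) : A.form x = lam := by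
  rw [form_eq_sum]
  simp only [h.1]
  calc ∑ i, x i * (lam * x i ^ (d + 1)) = lam * ∑ i, x i ^ (d + 2) := by
        rw [Finset.mul_sum]; exact Finset.sum_congr rfl fun i _ => by ring
    _ = lam := by rw [h.2, mul_one]

lemma sum_weighted_eigen (hsymm : A.IsSymmetric) (he : A.IsHEigenpair lam x) (v : Fin n → ℝ) :
    ∑ I, A I * (∏ l, x (I l)) * ∑ l, v (I l)
      = ((d + 2 : ℕ) : ℝ) * (lam * ∑ i, v i * x i ^ (d + 2)) := by
  rw [hsymm.sum_weighted x v, Finset.mul_sum (a := lam)]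
  congr 1
  refine Finset.sum_congr rfl fun i _ => ?_
  rw [he.1]; ring

/-- The total of the arithmetic-mean sides: weighted polarization with v = (y/x)^m, where the
eigenvalue equation turns the weights x_i (A x^(m-1))_i into λ x_i^m. -/
lemma sum_amgm (hsymm : A.IsSymmetric) (he : A.IsHEigenpair lam x) (hx : ∀ i, 0 < x i) :
    ∑ I, A I * (∏ l, x (I l)) * (((d + 2 : ℕ) : ℝ)⁻¹ * ∑ l, (y (I l) / x (I l)) ^ (d + 2))
      = lam * ∑ i, y i ^ (d + 2) := by
  have h := sum_weighted_eigen hsymm he (fun i => (y i / x i) ^ (d + 2))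
  have h2 : ∑ i, (y i / x i) ^ (d + 2) * x i ^ (d + 2) = ∑ i, y i ^ (d + 2) :=
    Finset.sum_congr rfl fun i _ => by rw [← mul_pow, div_mul_cancel₀ _ (hx i).ne']
  have hm : ((d + 2 : ℕ) : ℝ) ≠ 0 := by positivity
  rw [h2] at h
  rw [← mul_right_inj' hm, ← h, Finset.mul_sum]
  refine Finset.sum_congr rfl fun I _ => ?_
  field_simp

lemma form_eq_sum_ratio (hx : ∀ i, 0 < x i) :
    A.form y = ∑ I, A I * (∏ l, x (I l)) * ∏ l, (y (I l) / x (I l)) := by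
  refine Finset.sum_congr rfl fun I _ => ?_
  rw [mul_assoc, ← Finset.prod_mul_distrib]
  congr 1
  exact Finset.prod_congr rfl fun _ _ => by rw [mul_div_cancel₀ _ (hx _).ne']

lemma form_term_le (hnonneg : A.IsNonneg) (hx : ∀ i, 0 < x i) (hy : ∀ i, 0 ≤ y i)
    (I : Fin (d + 2) → Fin n) :
    A I * (∏ l, x (I l)) * ∏ l, (y (I l) / x (I l)) ≤
      A I * (∏ l, x (I l)) * (((d + 2 : ℕ) : ℝ)⁻¹ * ∑ l, (y (I l) / x (I l)) ^ (d + 2)) :=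
  mul_le_mul_of_nonneg_left
    (prod_le_mean_pow (k := d + 1) _ fun _ => div_nonneg (hy _) (hx _).le)
    (mul_nonneg (hnonneg I) (Finset.prod_nonneg fun _ _ => (hx _).le))

lemma form_le_of_eigen (hsymm : A.IsSymmetric) (hnonneg : A.IsNonneg)
    (he : A.IsHEigenpair lam x) (hx : ∀ i, 0 < x i) (hy : ∀ i, 0 ≤ y i) :
    A.form y ≤ lam * ∑ i, y i ^ (d + 2) := by
  rw [← sum_amgm hsymm he hx, form_eq_sum_ratio hx]
  exact Finset.sum_le_sum fun I _ => form_term_le hnonneg hx hy I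

/-- Equality of the sums forces equality in AM-GM for every index with a nonzero entry, so y/x is
constant along nonzero entries. Irreducibility makes it globally constant, and the normalization
makes that constant 1. -/
lemma eq_of_form_eq (hsymm : A.IsSymmetric) (hnonneg : A.IsNonneg) (hirr : A.IsIrreducible)
    (he : A.IsHEigenpair lam x) (hx : ∀ i, 0 < x i) (hy : y ∈ posSphere (d + 2) n)
    (h : A.form y = lam) : y = x := by
  obtain ⟨hy0, hy1⟩ := hy
  have hsum := sum_amgm (y := y) hsymm he hx
  rw [hy1, mul_one, ← h, form_eq_sum_ratio hx, eq_comm,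
    Finset.sum_eq_sum_iff_of_le fun I _ => form_term_le hnonneg hx (fun i => (hy0 i).le) I] at hsum
  have hr : ∀ i j, y i / x i = y j / x j := by
    refine hirr.eq_of_forall (r := fun i => y i / x i) fun i J hA => ?_
    have h1 := hsum (Matrix.vecCons i J) (Finset.mem_univ _)
    have h2 := mul_left_cancel₀
      (mul_ne_zero hA (Finset.prod_ne_zero_iff.mpr fun _ _ => (hx _).ne')) h1
    simpa using eq_of_prod_eq_mean_pow (k := d + 1) _
      (fun l => div_nonneg (hy0 _).le (hx _).le) h2 1 0
  funext i
  have hc : ∀ j, y j = y i / x i * x j := fun j => by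
    rw [hr i j, div_mul_cancel₀ _ (hx j).ne']
  have hpow : (y i / x i) ^ (d + 2) = 1 := by
    rw [← hy1, Finset.sum_congr rfl fun j _ => by rw [hc j, mul_pow], ← Finset.mul_sum, he.2,
      mul_one]
  have := (pow_eq_one_iff_of_nonneg (div_nonneg (hy0 i).le (hx i).le) (by omega)).mp hpow
  rw [hc i, this, one_mul]

lemma abs_contractVec_le (hnonneg : A.IsNonneg) (i : Fin n) :
    |A.contractVec y i| ≤ A.contractVec (fun j => |y j|) i := by
  refine (Finset.abs_sum_le_sum_abs _ _).trans (Finset.sum_le_sum fun J _ => ?_)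
  rw [abs_mul, Finset.abs_prod, abs_of_nonneg (hnonneg _)]

/-- For any other eigenpair (μ, y), taking absolute values gives |μ| Σ|y_i|^m ≤ A|y|^m, and the
AM-GM bound applies to |y|. -/
lemma IsHEigenpair.isSpectralRadius (hsymm : A.IsSymmetric) (hnonneg : A.IsNonneg)
    (he : A.IsHEigenpair lam x) (hx : ∀ i, 0 < x i) : A.IsSpectralRadius lam := by
  have hlam : 0 ≤ lam := he.form_eq ▸ hnonneg.form_nonneg fun i => (hx i).le
  refine ⟨⟨lam, x, he, (abs_of_nonneg hlam).symm⟩, ?_⟩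
  rintro _ ⟨mu, y, hy, rfl⟩
  have h1 : |mu| * ∑ i, |y i| ^ (d + 2) ≤ A.form (fun i => |y i|) := by
    rw [form_eq_sum, Finset.mul_sum]
    refine Finset.sum_le_sum fun i _ => ?_
    calc |mu| * |y i| ^ (d + 2) = |y i| * |A.contractVec y i| := by
          rw [hy.1, abs_mul, abs_pow]; ring
      _ ≤ _ := mul_le_mul_of_nonneg_left (abs_contractVec_le hnonneg i) (abs_nonneg _)
  have h2 := h1.trans (form_le_of_eigen hsymm hnonneg he hx fun i => abs_nonneg (y i))
  refine le_of_mul_le_mul_right h2 (lt_of_lt_of_le one_pos ?_)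
  rw [← hy.2]
  exact Finset.sum_le_sum fun i _ => (le_abs_self _).trans_eq (abs_pow _ _)

/-- Perron–Frobenius: an irreducible nonnegative symmetric tensor has a positive H-eigenvector. -/
lemma exists_pos_eigenpair (hsymm : A.IsSymmetric) (hnonneg : A.IsNonneg)
    (hirr : A.IsIrreducible) (hA : A ≠ 0) :
    ∃ (x : Fin n → ℝ) (lam : ℝ), A.IsHEigenpair lam x ∧ ∀ i, 0 < x i := by
  -- Supplies an index `I₀ 0`, so that n > 0.
  obtain ⟨I₀, -⟩ := Function.ne_iff.mp hA
  let K : Set (Fin n → ℝ) := {x | (∀ i, 0 ≤ x i) ∧ ∑ i, x i ^ (d + 2) = 1}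
  have hKc : IsCompact K := by
    refine (isCompact_Icc (a := (0 : Fin n → ℝ)) (b := 1)).of_isClosed_subset ?_ ?_
    · refine IsClosed.inter (s₁ := {x : Fin n → ℝ | ∀ i, 0 ≤ x i}) ?_ ?_
      · simp only [Set.ofPred_forall]
        exact isClosed_iInter fun i => isClosed_le continuous_const (continuous_apply i)
      · exact isClosed_eq (by fun_prop) continuous_const
    · rintro x ⟨h0, h1⟩
      refine ⟨h0, fun i => ?_⟩
      refine (pow_le_one_iff_of_nonneg (h0 i) (n := d + 2) (by omega)).mp ?_
      rw [← h1]
      exact Finset.single_le_sum (f := fun i => x i ^ (d + 2))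
        (fun j _ => pow_nonneg (h0 j) _) (Finset.mem_univ i)
  have hKn : K.Nonempty := by
    refine ⟨Pi.single (I₀ 0) 1, fun i => ?_, ?_⟩
    · by_cases h : i = I₀ 0 <;> simp [h]
    · simp [Pi.single_apply, ite_pow]
  obtain ⟨x, ⟨hx0, hx1⟩, hmax⟩ := hKc.exists_isMaxOn hKn A.continuous_form.continuousOn
  set lam := A.form x with hlam
  -- By homogeneity the constrained maximum becomes an inequality on the whole orthant, so x
  -- maximizes A y^m - λ Σ y_i^m there and no multiplier rule is needed.
  have hle : ∀ y : Fin n → ℝ, (∀ i, 0 ≤ y i) → A.form y ≤ lam * ∑ i, y i ^ (d + 2) := by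
    intro y hy
    have hs0 : 0 ≤ ∑ i, y i ^ (d + 2) := Finset.sum_nonneg fun i _ => pow_nonneg (hy i) _
    rcases hs0.eq_or_lt with hs | hs
    · have hy' : ∀ i, y i = 0 := fun i => by
        have := (Finset.sum_eq_zero_iff_of_nonneg fun i _ => pow_nonneg (hy i) _).mp hs.symm i
          (Finset.mem_univ i)
        exact pow_eq_zero_iff (by omega) |>.mp this
      rw [← hs, mul_zero, form]
      refine (Finset.sum_eq_zero fun I _ => ?_).le
      rw [Finset.prod_eq_zero (Finset.mem_univ (0 : Fin (d + 2))) (hy' _), mul_zero]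
    · set s := ∑ i, y i ^ (d + 2)
      set c := s ^ (((d + 2 : ℕ) : ℝ)⁻¹) with hc
      have hc0 : 0 < c := Real.rpow_pos_of_pos hs _
      have hcs : c ^ (d + 2) = s := Real.rpow_inv_natCast_pow hs.le (by omega)
      have hmem : c⁻¹ • y ∈ K := by
        refine ⟨fun i => mul_nonneg (inv_nonneg.mpr hc0.le) (hy i), ?_⟩
        simp only [Pi.smul_apply, smul_eq_mul, mul_pow, ← Finset.mul_sum, inv_pow]
        rw [hcs]
        exact inv_mul_cancel₀ hs.ne'
      have h1 : A.form (c⁻¹ • y) ≤ lam := hmax hmem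
      rw [form_smul, inv_pow, hcs, inv_mul_le_iff₀ hs] at h1
      linarith
  have hlam0 : 0 < lam := by
    have h1 := hle 1 fun _ => zero_le_one
    have h2 := hnonneg.form_pos hA (x := 1) fun _ => one_pos
    have h3 : 0 < lam * ∑ i : Fin n, (1 : Fin n → ℝ) i ^ (d + 2) := h2.trans_le h1
    exact (pos_iff_pos_of_mul_pos h3).mpr (by simp [Fin.pos (I₀ 0)])
  -- Increasing one coordinate stays in the orthant, so each partial derivative at the maximizer is
  -- nonpositive.
  have hsub : ∀ i, A.contractVec x i ≤ lam * x i ^ (d + 1) := by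
    intro i
    let P : Set (Fin n → ℝ) := {y | ∀ i, 0 ≤ y i}
    have hM : IsLocalMaxOn (fun y => A.form y - lam * ∑ j, y j ^ (d + 2)) P x := by
      refine IsMaxOn.localize fun y hy => ?_
      simp only [Set.mem_ofPred_eq, hx1, mul_one, ← hlam, sub_self, sub_nonpos]
      exact hle y hy
    have hd : HasFDerivAt (fun y : Fin n → ℝ => A.form y - lam * ∑ j, y j ^ (d + 2)) _ x :=
      (hsymm.hasFDerivAt_form x).sub ((HasFDerivAt.fun_sum (u := Finset.univ) fun j _ =>
        (hasFDerivAt_apply (𝕜 := ℝ) j x).pow (d + 2)).const_mul lam)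
    have ht := hM.hasFDerivWithinAt_nonpos hd.hasFDerivWithinAt (y := Pi.single i 1) (by
      refine mem_posTangentConeAt_of_segment_subset fun z hz j => ?_
      obtain ⟨t, ht, rfl⟩ := segment_eq_image' ℝ x (x + Pi.single i 1) ▸ hz
      have : (0 : ℝ) ≤ (Pi.single i 1 : Fin n → ℝ) j := by
        by_cases h : j = i <;> simp [h]
      have := mul_nonneg ht.1 this
      simpa using add_nonneg (hx0 j) this)
    simp [Pi.single_apply] at ht
    nlinarith
  -- Multiplied by x_i and summed, both sides of the inequality give λ, so it is an equality term by
  -- term.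
  have heq0 : ∀ i, x i * A.contractVec x i = x i * (lam * x i ^ (d + 1)) := by
    have h1 : ∑ i, x i * A.contractVec x i = ∑ i, x i * (lam * x i ^ (d + 1)) := by
      rw [← form_eq_sum, ← hlam]
      calc lam = lam * ∑ i, x i ^ (d + 2) := by rw [hx1, mul_one]
        _ = _ := by rw [Finset.mul_sum]; exact Finset.sum_congr rfl fun i _ => by ring
    rw [Finset.sum_eq_sum_iff_of_le fun i _ => mul_le_mul_of_nonneg_left (hsub i) (hx0 i)] at h1
    exact fun i => h1 i (Finset.mem_univ i)
  -- Otherwise the zero set of x would witness reducibility.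
  have hpos : ∀ i, 0 < x i := by
    by_contra hcon
    push Not at hcon
    obtain ⟨i, hi⟩ := hcon
    refine hirr ⟨{i | x i = 0}, ⟨i, le_antisymm hi (hx0 i)⟩, fun h => ?_, fun a ha J hJ => ?_⟩
    · have : ∀ j, x j = 0 := fun j => by
        have : j ∈ {i | x i = 0} := h ▸ Set.mem_univ j
        exact this
      simp [this] at hx1
    · have h1 : A.contractVec x a = 0 := by
        refine le_antisymm ?_ (hnonneg.contractVec_nonneg hx0 a)
        have := hsub a
        rwa [show x a = 0 from ha, zero_pow (by omega), mul_zero] at this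
      rw [contractVec, Finset.sum_eq_zero_iff_of_nonneg fun J _ =>
        mul_nonneg (hnonneg _) (Finset.prod_nonneg fun _ _ => hx0 _)] at h1
      have h2 := h1 J (Finset.mem_univ _)
      exact (mul_eq_zero.mp h2).resolve_right (Finset.prod_ne_zero_iff.mpr fun l _ => hJ l)
  exact ⟨x, lam, ⟨fun i => mul_left_cancel₀ (hpos i).ne' (heq0 i), hx1⟩, hpos⟩

end Eigen

lemma existsUnique_perronPair (A : Tensor (d + 2) n) (hsymm : A.IsSymmetric)
    (hnonneg : A.IsNonneg) (hirr : A.IsIrreducible) (hA : A ≠ 0) :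
    ∃! p : (Fin n → ℝ) × ℝ, A.IsPerronPair p.1 p.2 := by
  obtain ⟨x, lam, he, hx⟩ := exists_pos_eigenpair hsymm hnonneg hirr hA
  have hs := he.isSpectralRadius hsymm hnonneg hx
  refine ⟨(x, lam), ⟨hs, he, hx⟩, ?_⟩
  rintro ⟨y, mu⟩ ⟨hs', he', hy⟩
  obtain rfl : mu = lam := hs'.unique hs
  exact Prod.ext (eq_of_form_eq hsymm hnonneg hirr he hx ⟨hy, he'.2⟩ he'.form_eq) rfl

end PowerLike.Tensor

/-! ### Reversible Markov kernels and their L² contraction. -/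

namespace PowerLike

section Markov

variable {n : ℕ} {w : Fin n → ℝ} {Q : Fin n → Fin n → ℝ}

/-- Variance decomposition for a reversible Markov kernel. -/
lemma sum_sq_markov (hw1 : ∑ i, w i = 1) (hQ1 : ∀ i, ∑ j, Q i j = 1)
    (hrev : ∀ i j, w i * Q i j = w j * Q j i) (r : Fin n → ℝ) :
    ∑ i, w i * (∑ j, Q i j * r j - ∑ j, w j * r j) ^ 2 =
      ∑ i, w i * r i ^ 2 - (∑ j, w j * r j) ^ 2
        - ∑ i, w i * ∑ j, Q i j * (r j - ∑ l, Q i l * r l) ^ 2 := by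
  have hswap : ∀ s : Fin n → ℝ, ∑ i, w i * ∑ j, Q i j * s j = ∑ j, w j * s j := by
    intro s
    simp_rw [Finset.mul_sum]
    rw [Finset.sum_comm]
    refine Finset.sum_congr rfl fun j _ => ?_
    simp_rw [← mul_assoc, hrev _ j]
    rw [← Finset.sum_mul, ← Finset.mul_sum, hQ1, mul_one]
  have hvar : ∀ i, ∑ j, Q i j * (r j - ∑ l, Q i l * r l) ^ 2
      = ∑ j, Q i j * r j ^ 2 - (∑ l, Q i l * r l) ^ 2 := by
    intro i
    set q := ∑ l, Q i l * r l with hq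
    have : ∀ j, Q i j * (r j - q) ^ 2 = Q i j * r j ^ 2 - 2 * q * (Q i j * r j) + q ^ 2 * Q i j :=
      fun j => by ring
    simp_rw [this]
    rw [Finset.sum_add_distrib, Finset.sum_sub_distrib, ← Finset.mul_sum, ← Finset.mul_sum, ← hq,
      hQ1]
    ring
  set c := ∑ j, w j * r j with hc
  have hlhs : ∀ i, w i * (∑ j, Q i j * r j - c) ^ 2
      = w i * (∑ j, Q i j * r j) ^ 2 - 2 * c * (w i * ∑ j, Q i j * r j) + c ^ 2 * w i :=
    fun i => by ring
  simp_rw [hlhs, hvar, mul_sub]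
  rw [Finset.sum_add_distrib, Finset.sum_sub_distrib, Finset.sum_sub_distrib, ← Finset.mul_sum,
    ← Finset.mul_sum, hswap r, hw1, hswap (fun j => r j ^ 2), ← hc]
  ring

/-- If nothing is lost, the mean and all conditional variances vanish. Then r is constant on the
support of each row, which contains i itself because the diagonal is positive. Connectedness makes r
constant, and mean zero makes it 0. -/
lemma sum_sq_markov_lt (hw : ∀ i, 0 < w i) (hw1 : ∑ i, w i = 1) (hQ : ∀ i j, 0 ≤ Q i j)
    (hQ1 : ∀ i, ∑ j, Q i j = 1) (hrev : ∀ i j, w i * Q i j = w j * Q j i)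
    (hdiag : ∀ i, 0 < Q i i)
    (hconn : ∀ r : Fin n → ℝ, (∀ i j, 0 < Q i j → r j = r i) → ∀ i j, r i = r j)
    {r : Fin n → ℝ} (hr : r ≠ 0) :
    ∑ i, w i * (∑ j, Q i j * r j - ∑ j, w j * r j) ^ 2 < ∑ i, w i * r i ^ 2 := by
  rw [sum_sq_markov hw1 hQ1 hrev]
  have hin : ∀ i j, 0 ≤ Q i j * (r j - ∑ l, Q i l * r l) ^ 2 :=
    fun i j => mul_nonneg (hQ i j) (sq_nonneg _)
  have hout : ∀ i, 0 ≤ w i * ∑ j, Q i j * (r j - ∑ l, Q i l * r l) ^ 2 :=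
    fun i => mul_nonneg (hw i).le (Finset.sum_nonneg fun j _ => hin i j)
  have hv := Finset.sum_nonneg fun i (_ : i ∈ Finset.univ) => hout i
  by_contra hcon
  have hc0 : ∑ j, w j * r j = 0 := by
    have := sq_nonneg (∑ j, w j * r j)
    exact pow_eq_zero_iff (two_ne_zero) |>.mp (by linarith)
  have hv0 : ∑ i, w i * ∑ j, Q i j * (r j - ∑ l, Q i l * r l) ^ 2 = 0 := by
    have := sq_nonneg (∑ j, w j * r j)
    linarith
  have hz : ∀ i j, 0 < Q i j → r j = ∑ l, Q i l * r l := by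
    intro i j hij
    have h1 := (Finset.sum_eq_zero_iff_of_nonneg fun i _ => hout i).mp hv0 i (Finset.mem_univ i)
    have h2 := (mul_eq_zero.mp h1).resolve_left (hw i).ne'
    have h3 := (Finset.sum_eq_zero_iff_of_nonneg fun j _ => hin i j).mp h2 j (Finset.mem_univ j)
    have h4 := (mul_eq_zero.mp h3).resolve_left hij.ne'
    exact sub_eq_zero.mp (pow_eq_zero_iff two_ne_zero |>.mp h4)
  have hconst := hconn r fun i j hij => (hz i j hij).trans (hz i i (hdiag i)).symm
  refine hr (funext fun i => ?_)
  rw [Finset.sum_congr rfl fun j _ => by rw [hconst j i], ← Finset.sum_mul, hw1, one_mul] at hc0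
  exact hc0

/-- Both sides are continuous and homogeneous of degree 2, so the strict inequality becomes uniform
by compactness of the unit sphere. -/
lemma exists_markov_contraction (hw : ∀ i, 0 < w i) (hw1 : ∑ i, w i = 1) (hQ : ∀ i j, 0 ≤ Q i j)
    (hQ1 : ∀ i, ∑ j, Q i j = 1) (hrev : ∀ i j, w i * Q i j = w j * Q j i)
    (hdiag : ∀ i, 0 < Q i i)
    (hconn : ∀ r : Fin n → ℝ, (∀ i j, 0 < Q i j → r j = r i) → ∀ i j, r i = r j) :
    ∃ δ ∈ Set.Ioo (0 : ℝ) 1, ∀ r : Fin n → ℝ,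
      ∑ i, w i * (∑ j, Q i j * r j - ∑ j, w j * r j) ^ 2 ≤ δ * ∑ i, w i * r i ^ 2 := by
  set φ : (Fin n → ℝ) → ℝ := fun r => ∑ i, w i * (∑ j, Q i j * r j - ∑ j, w j * r j) ^ 2 with hφ
  set ψ : (Fin n → ℝ) → ℝ := fun r => ∑ i, w i * r i ^ 2 with hψ
  have hlt : ∀ r, r ≠ 0 → φ r < ψ r := fun r hr =>
    sum_sq_markov_lt hw hw1 hQ hQ1 hrev hdiag hconn hr
  have hφ0 : ∀ r, 0 ≤ φ r := fun r =>
    Finset.sum_nonneg fun i _ => mul_nonneg (hw i).le (sq_nonneg _)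
  have hφs : ∀ (c : ℝ) r, φ (c • r) = c ^ 2 * φ r := by
    intro c r
    simp only [hφ, Pi.smul_apply, smul_eq_mul, mul_left_comm _ c, ← Finset.mul_sum, ← mul_sub,
      mul_pow]
    simp only [mul_left_comm _ (c ^ 2), ← Finset.mul_sum]
  have hψs : ∀ (c : ℝ) r, ψ (c • r) = c ^ 2 * ψ r := by
    intro c r
    simp only [hψ, Pi.smul_apply, smul_eq_mul, mul_left_comm _ (c ^ 2), ← Finset.mul_sum, mul_pow]
  have hex : ∃ δ ∈ Set.Ioo (0 : ℝ) 1, ∀ r ∈ Metric.sphere (0 : Fin n → ℝ) 1, φ r ≤ δ * ψ r := by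
    rcases (Metric.sphere (0 : Fin n → ℝ) 1).eq_empty_or_nonempty with he | hne
    · exact ⟨1 / 2, by norm_num, by simp [he]⟩
    have hn0 : ∀ r ∈ Metric.sphere (0 : Fin n → ℝ) 1, r ≠ 0 := fun r hr h => by simp [h] at hr
    have hψ0 : ∀ r ∈ Metric.sphere (0 : Fin n → ℝ) 1, 0 < ψ r := fun r hr =>
      (hφ0 r).trans_lt (hlt r (hn0 r hr))
    obtain ⟨r₀, hr₀, hmax⟩ := (isCompact_sphere (0 : Fin n → ℝ) 1).exists_isMaxOn hne
      (f := fun r => φ r / ψ r) (ContinuousOn.div (by fun_prop) (by fun_prop)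
        fun r hr => (hψ0 r hr).ne')
    -- The maximal ratio may be 0; the maximum with 1/2 keeps δ positive.
    refine ⟨max (φ r₀ / ψ r₀) (1 / 2), ⟨by positivity, max_lt ?_ (by norm_num)⟩, fun r hr => ?_⟩
    · rw [div_lt_one (hψ0 r₀ hr₀)]
      exact hlt r₀ (hn0 r₀ hr₀)
    · rw [← div_le_iff₀ (hψ0 r hr)]
      exact (hmax hr).trans (le_max_left _ _)
  obtain ⟨δ, hδ, h⟩ := hex
  refine ⟨δ, hδ, fun r => ?_⟩
  rcases eq_or_ne r 0 with rfl | hr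
  · simp
  have hnr : ‖r‖ ≠ 0 := norm_ne_zero_iff.mpr hr
  have h1 := h (‖r‖⁻¹ • r) (by simp [norm_smul, hnr])
  rw [hφs, hψs, mul_left_comm] at h1
  exact le_of_mul_le_mul_left h1 (by positivity)

end Markov

namespace Tensor

variable {d n : ℕ} {A : Tensor (d + 2) n} {x : Fin n → ℝ} {lam : ℝ}

/-- The transition kernel `(I + (m-1) P) / m`, where `P` is the stochastic matrix obtained from
`A x^(m-2)` by diagonal scaling. -/
def kernel (A : Tensor (d + 2) n) (x : Fin n → ℝ) (lam : ℝ) (i j : Fin n) : ℝ :=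
  ((d + 2 : ℕ) : ℝ)⁻¹ * ((if i = j then 1 else 0)
    + ((d + 1 : ℕ) : ℝ) * (A.contractMat x i j * x j / (lam * x i ^ (d + 1))))

/-- Row sums are 1 by the eigenvalue equation, reversibility for w = x^[m] is the symmetry of A
x^(m-2), and the I/m part gives the positive diagonal. Connectedness follows from irreducibility. -/
lemma exists_kernel_contraction (hsymm : A.IsSymmetric) (hnonneg : A.IsNonneg)
    (hirr : A.IsIrreducible) (he : A.IsHEigenpair lam x) (hx : ∀ i, 0 < x i) (hlam : 0 < lam) :
    ∃ δ ∈ Set.Ioo (0 : ℝ) 1, ∀ r : Fin n → ℝ,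
      ∑ i, x i ^ (d + 2) * (∑ j, A.kernel x lam i j * r j - ∑ j, x j ^ (d + 2) * r j) ^ 2
        ≤ δ * ∑ i, x i ^ (d + 2) * r i ^ 2 := by
  have hm : (0 : ℝ) < ((d + 2 : ℕ) : ℝ) := by positivity
  have hmat : ∀ i j, 0 ≤ A.contractMat x i j := hnonneg.contractMat_nonneg fun i => (hx i).le
  have hP : ∀ i j, 0 ≤ A.contractMat x i j * x j / (lam * x i ^ (d + 1)) := fun i j =>
    div_nonneg (mul_nonneg (hmat i j) (hx j).le) (mul_nonneg hlam.le (pow_nonneg (hx i).le _))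
  have hd1 : (0 : ℝ) < ((d + 1 : ℕ) : ℝ) := by positivity
  refine exists_markov_contraction (fun i => pow_pos (hx i) _) he.2 (fun i j => ?_) (fun i => ?_)
    (fun i j => ?_) (fun i => ?_) fun r hr => ?_
  · refine mul_nonneg (inv_nonneg.mpr hm.le) (add_nonneg ?_ (mul_nonneg hd1.le (hP i j)))
    split_ifs <;> norm_num
  · simp only [kernel]
    rw [← Finset.mul_sum, Finset.sum_add_distrib, ← Finset.mul_sum, ← Finset.sum_div,
      ← contractVec_eq_sum, he.1, div_self (mul_pos hlam (pow_pos (hx i) _)).ne']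
    simp
    field_simp
    ring
  · rcases eq_or_ne i j with rfl | hij
    · rfl
    · simp only [kernel, hij, hij.symm, if_false, hsymm.contractMat_comm x i j, zero_add]
      have := (hx i).ne'
      have := (hx j).ne'
      have := hlam.ne'
      field_simp
      ring
  · refine mul_pos (inv_pos.mpr hm) (add_pos_of_pos_of_nonneg ?_ (mul_nonneg hd1.le (hP i i)))
    simp
  · refine hirr.eq_of_forall fun i J hJ => hr i (J 0) ?_
    have hp : 0 < A.contractMat x i (J 0) := by
      refine Finset.sum_pos' (fun K _ => mul_nonneg (hnonneg _)
        (Finset.prod_nonneg fun _ _ => (hx _).le)) ⟨Matrix.vecTail J, Finset.mem_univ _,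
        mul_pos ((hnonneg _).lt_of_ne' ?_) (Finset.prod_pos fun _ _ => hx _)⟩
      have : Matrix.vecCons (J 0) (Matrix.vecTail J) = J := Matrix.cons_head_tail J
      rwa [this]
    refine mul_pos (inv_pos.mpr hm) (add_pos_of_nonneg_of_pos ?_ (mul_pos hd1 ?_))
    · split_ifs <;> norm_num
    · exact div_pos (mul_pos hp (hx _)) (mul_pos hlam (pow_pos (hx i) _))

end Tensor
end PowerLike

/-! ### Spectral radius of the iteration matrix. -/

namespace PowerLike

/-- A real matrix contracting the Euclidean norm has complex spectral radius less than one. -/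
lemma spectralRadius_map_lt_one {n : ℕ} {T : Matrix (Fin n) (Fin n) ℝ} {δ : ℝ}
    (hδ : δ ∈ Set.Ioo (0 : ℝ) 1)
    (hT : ∀ q : Fin n → ℝ, ∑ i, (T.mulVec q i) ^ 2 ≤ δ * ∑ i, q i ^ 2) :
    spectralRadius ℂ (T.map (algebraMap ℝ ℂ)) < 1 := by
  have hb : spectralRadius ℂ (T.map (algebraMap ℝ ℂ)) ≤ ((Real.sqrt δ).toNNReal : ENNReal) := by
    refine iSup₂_le fun μ hμ => ?_
    rw [ENNReal.coe_le_coe, ← NNReal.coe_le_coe, coe_nnnorm,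
      Real.coe_toNNReal _ (Real.sqrt_nonneg _)]
    have hdet : (Matrix.scalar (Fin n) μ - T.map (algebraMap ℝ ℂ)).det = 0 := by
      by_contra hne
      exact hμ ((Matrix.isUnit_iff_isUnit_det _).mpr (isUnit_iff_ne_zero.mpr hne))
    obtain ⟨v, hv0, hv⟩ := Matrix.exists_mulVec_eq_zero_iff.mpr hdet
    have hev : ∀ i, μ * v i = ∑ j, (T i j : ℂ) * v j := by
      intro i
      have := congrFun hv i
      rw [Matrix.sub_mulVec, Pi.sub_apply, Matrix.scalar_apply, Matrix.mulVec_diagonal,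
        Pi.zero_apply, sub_eq_zero] at this
      simpa [Matrix.mulVec, dotProduct] using this
    -- T is real, so it acts separately on the real and imaginary parts of a complex eigenvector,
    -- and the real contraction bound applies to each.
    have hre : ∀ i, (μ * v i).re = T.mulVec (fun j => (v j).re) i := by
      intro i
      rw [hev]
      simp [Matrix.mulVec, dotProduct]
    have him : ∀ i, (μ * v i).im = T.mulVec (fun j => (v j).im) i := by
      intro i
      rw [hev]
      simp [Matrix.mulVec, dotProduct]
    have hsq : ∀ z : ℂ, ‖z‖ ^ 2 = z.re ^ 2 + z.im ^ 2 := fun z => by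
      rw [Complex.sq_norm, Complex.normSq_apply]; ring
    have hle : ‖μ‖ ^ 2 * ∑ i, ‖v i‖ ^ 2 ≤ δ * ∑ i, ‖v i‖ ^ 2 := by
      have h1 := hT fun j => (v j).re
      have h2 := hT fun j => (v j).im
      have h3 : ∀ i, ‖μ‖ ^ 2 * ‖v i‖ ^ 2 = T.mulVec (fun j => (v j).re) i ^ 2
          + T.mulVec (fun j => (v j).im) i ^ 2 := fun i => by
        rw [← mul_pow, ← norm_mul, hsq, hre, him]
      rw [Finset.mul_sum, Finset.sum_congr rfl fun i _ => h3 i]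
      simp only [hsq, Finset.sum_add_distrib, mul_add]
      linarith
    have hpos : 0 < ∑ i, ‖v i‖ ^ 2 := by
      obtain ⟨i, hi⟩ := Function.ne_iff.mp hv0
      exact Finset.sum_pos' (fun i _ => sq_nonneg _)
        ⟨i, Finset.mem_univ _, pow_pos (norm_pos_iff.mpr hi) 2⟩
    exact Real.le_sqrt_of_sq_le (le_of_mul_le_mul_right hle hpos)
  refine hb.trans_lt ?_
  rw [← ENNReal.coe_one, ENNReal.coe_lt_coe, Real.toNNReal_lt_one, Real.sqrt_lt' one_pos]
  simpa using hδ.2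

namespace Tensor

variable {d n : ℕ} {A : Tensor (d + 2) n} {x : Fin n → ℝ} {lam : ℝ}

/-- In matrix form, T = D (K - 1 wᵀ) D⁻¹ with D = diag(x^[m/2]) and w = x^[m]. -/
lemma iterMat_apply (he : A.IsHEigenpair lam x) (hx : ∀ i, 0 < x i) (hlam : 0 < lam)
    (i j : Fin n) :
    A.iterMat x lam i j = x i ^ ((d : ℝ) / 2) * x i * (A.kernel x lam i j - x j ^ (d + 2))
      / (x j ^ ((d : ℝ) / 2) * x j) := by
  have hD : ∀ i, x i ^ (-(d : ℝ) / 2) = (x i ^ ((d : ℝ) / 2))⁻¹ := fun i => by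
    rw [neg_div, Real.rpow_neg (hx i).le]
  have hsq : ∀ i, x i ^ d = x i ^ ((d : ℝ) / 2) * x i ^ ((d : ℝ) / 2) := fun i => by
    rw [← Real.rpow_add (hx i), add_halves, Real.rpow_natCast]
  have he0 : ∀ i, x i ^ ((d : ℝ) / 2) ≠ 0 := fun i => (Real.rpow_pos_of_pos (hx i) _).ne'
  have hx0 : ∀ i, x i ≠ 0 := fun i => (hx i).ne'
  have hl0 := hlam.ne'
  have hm : ((d + 2 : ℕ) : ℝ) ≠ 0 := by positivity
  simp only [iterMat, matB, Matrix.smul_apply, Matrix.mul_diagonal, Matrix.diagonal_mul, hD,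
    Matrix.sub_apply, Matrix.vecMulVec_apply, smul_eq_mul, he.form_eq, he.1, kernel, pow_succ]
  set e := fun i => x i ^ ((d : ℝ) / 2) with hedef
  simp only [hsq, Matrix.diagonal_apply]
  change ∀ i, e i ≠ 0 at he0
  change _ * ((e i)⁻¹ * (_ * (_ * (e i * e i * x i) * (_ * (e j * e j * x j))) - _ - _) * (e j)⁻¹) =
    e i * x i * (_ * (_ + _ * (_ / (_ * (e i * e i * _)))) - e j * e j * _ * _) / (e j * _)
  rcases eq_or_ne i j with rfl | hij
  · have := he0 i
    have := hx0 i
    simp only [if_true]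
    change _ * (_ * (_ - _ - lam * (e i * e i * x i) / x i) * _) = _
    field_simp
    ring
  · have := he0 i
    have := hx0 i
    have := he0 j
    have := hx0 j
    simp only [hij, if_false]
    field_simp
    ring

lemma spectralRadius_iterMat_lt_one (hsymm : A.IsSymmetric) (hnonneg : A.IsNonneg)
    (hirr : A.IsIrreducible) (he : A.IsHEigenpair lam x) (hx : ∀ i, 0 < x i) (hlam : 0 < lam) :
    spectralRadius ℂ ((A.iterMat x lam).map (algebraMap ℝ ℂ)) < 1 := by
  obtain ⟨δ, hδ, h⟩ := exists_kernel_contraction hsymm hnonneg hirr he hx hlam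
  refine spectralRadius_map_lt_one hδ fun q => ?_
  have he0 : ∀ i, 0 < x i ^ ((d : ℝ) / 2) * x i := fun i =>
    mul_pos (Real.rpow_pos_of_pos (hx i) _) (hx i)
  have hsq : ∀ i, x i ^ (d + 2) = (x i ^ ((d : ℝ) / 2) * x i) ^ 2 := fun i => by
    rw [mul_pow, ← Real.rpow_natCast (x i ^ _), ← Real.rpow_mul (hx i).le, pow_add]
    congr 1
    rw [← Real.rpow_natCast]
    congr 1
    push_cast
    ring
  have h1 := h fun j => q j / (x j ^ ((d : ℝ) / 2) * x j)
  have hT : ∀ i, (A.iterMat x lam).mulVec q i = x i ^ ((d : ℝ) / 2) * x i *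
      (∑ j, A.kernel x lam i j * (q j / (x j ^ ((d : ℝ) / 2) * x j))
        - ∑ j, x j ^ (d + 2) * (q j / (x j ^ ((d : ℝ) / 2) * x j))) := by
    intro i
    rw [← Finset.sum_sub_distrib, Finset.mul_sum]
    change ∑ j, A.iterMat x lam i j * q j = _
    refine Finset.sum_congr rfl fun j _ => ?_
    rw [iterMat_apply he hx hlam]
    ring
  have hq : ∀ i, x i ^ (d + 2) * (q i / (x i ^ ((d : ℝ) / 2) * x i)) ^ 2 = q i ^ 2 := fun i => by
    rw [hsq, ← mul_pow, mul_div_cancel₀ _ (he0 i).ne']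
  simp only [hq] at h1
  refine le_trans (le_of_eq ?_) h1
  exact Finset.sum_congr rfl fun i _ => by rw [hT, mul_pow, ← hsq]

end Tensor
end PowerLike

/-! ### Jensen's inequality and global convergence. -/

namespace PowerLike.Tensor

variable {k d n : ℕ}

/-- Jensen's inequality for the logarithm of a form. -/
lemma IsNonneg.jensen_log {B : Tensor k n} (hB : B.IsNonneg) {x y : Fin n → ℝ}
    (hx : ∀ i, 0 < x i) (hy : ∀ i, 0 < y i) (hF : 0 < B.form x) :
    ∑ I, B I * (∏ l, x (I l)) * ∑ l, Real.log (y (I l) / x (I l))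
      ≤ B.form x * Real.log (B.form y / B.form x) := by
  have hB0 : B ≠ 0 := by
    rintro rfl
    simp [form] at hF
  have hG : 0 < B.form y := hB.form_pos hB0 hy
  set s := B.form y / B.form x with hs
  have hs0 : 0 < s := div_pos hG hF
  have hterm : ∀ I ∈ (Finset.univ : Finset (Fin k → Fin n)),
      B I * (∏ l, x (I l)) * ∑ l, Real.log (y (I l) / x (I l))
        ≤ B I * (∏ l, x (I l)) * (Real.log s - 1) + s⁻¹ * (B I * ∏ l, y (I l)) := by
    intro I _
    have hpx : 0 < ∏ l, x (I l) := Finset.prod_pos fun _ _ => hx _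
    have hpy : 0 < ∏ l, y (I l) := Finset.prod_pos fun _ _ => hy _
    have ht : 0 < (∏ l, y (I l)) / ∏ l, x (I l) := div_pos hpy hpx
    rw [← Real.log_prod fun l _ => (div_pos (hy _) (hx _)).ne', Finset.prod_div_distrib]
    -- The tangent to log at s, the weighted mean of the ratios ∏ y/x; summing over I then gives
    -- Jensen's inequality.
    have h1 := Real.log_le_sub_one_of_pos (div_pos ht hs0)
    rw [Real.log_div ht.ne' hs0.ne'] at h1
    have h2 := mul_le_mul_of_nonneg_left h1 (mul_nonneg (hB I) hpx.le)
    have h3 : B I * (∏ l, x (I l)) * ((∏ l, y (I l)) / (∏ l, x (I l)) / s)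
        = s⁻¹ * (B I * ∏ l, y (I l)) := by
      field_simp
    linarith
  refine (Finset.sum_le_sum hterm).trans (le_of_eq ?_)
  rw [Finset.sum_add_distrib, ← Finset.sum_mul, ← Finset.mul_sum]
  change B.form x * (Real.log s - 1) + s⁻¹ * B.form y = _
  have : s⁻¹ * B.form y = B.form x := by rw [hs]; field_simp
  rw [this]; ring

lemma le_one_of_mem_posSphere {x : Fin n → ℝ} (hx : x ∈ posSphere (d + 2) n) (i : Fin n) :
    x i ≤ 1 := by
  refine (pow_le_one_iff_of_nonneg (hx.1 i).le (n := d + 2) (by omega)).mp ?_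
  rw [← hx.2]
  exact Finset.single_le_sum (f := fun i => x i ^ (d + 2))
    (fun j _ => pow_nonneg (hx.1 j).le _) (Finset.mem_univ i)

/-- A nonnegative irreducible symmetric tensor with a positive H-eigenvector for a positive
H-eigenvalue. -/
structure IsPosEigenpair (A : Tensor (d + 2) n) (lam : ℝ) (x : Fin n → ℝ) : Prop where
  symm : A.IsSymmetric
  nonneg : A.IsNonneg
  irr : A.IsIrreducible
  eigen : A.IsHEigenpair lam x
  pos : ∀ i, 0 < x i
  lam_pos : 0 < lam

namespace IsPosEigenpair

variable {A : Tensor (d + 2) n} {x y : Fin n → ℝ} {lam : ℝ}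

lemma mem_posSphere (h : A.IsPosEigenpair lam x) : x ∈ posSphere (d + 2) n := ⟨h.pos, h.eigen.2⟩

lemma ne_zero (h : A.IsPosEigenpair lam x) : A ≠ 0 := by
  rintro rfl
  have := h.eigen.form_eq
  simp only [form, Pi.zero_apply, zero_mul, Finset.sum_const_zero] at this
  exact h.lam_pos.ne this

lemma form_pos (h : A.IsPosEigenpair lam x) (hy : ∀ i, 0 < y i) : 0 < A.form y :=
  h.nonneg.form_pos h.ne_zero hy

lemma contractVec_pos (h : A.IsPosEigenpair lam x) (hy : ∀ i, 0 < y i) (i : Fin n) :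
    0 < A.contractVec y i := by
  refine (h.nonneg.slice i).form_pos (fun h0 => ?_) hy
  have h1 := h.eigen.1 i
  rw [contractVec_eq_form_slice, h0] at h1
  simp only [form, Pi.zero_apply, zero_mul, Finset.sum_const_zero] at h1
  exact (mul_pos h.lam_pos (pow_pos (h.pos i) _)).ne h1

lemma form_le (h : A.IsPosEigenpair lam x) (hy : y ∈ posSphere (d + 2) n) : A.form y ≤ lam := by
  have := form_le_of_eigen h.symm h.nonneg h.eigen h.pos fun i => (hy.1 i).le
  rwa [hy.2, mul_one] at this

lemma powerStep_pow (h : A.IsPosEigenpair lam x) (hy : ∀ i, 0 < y i) (i : Fin n) :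
    A.powerStep y i ^ (d + 2) = A.contractVec y i * y i / A.form y := by
  rw [powerStep, one_div]
  exact Real.rpow_inv_natCast_pow
    (div_pos (mul_pos (h.contractVec_pos hy i) (hy i)) (h.form_pos hy)).le (by omega)

lemma powerStep_mem (h : A.IsPosEigenpair lam x) (hy : ∀ i, 0 < y i) :
    A.powerStep y ∈ posSphere (d + 2) n := by
  refine ⟨fun i => Real.rpow_pos_of_pos
    (div_pos (mul_pos (h.contractVec_pos hy i) (hy i)) (h.form_pos hy)) _, ?_⟩
  simp only [h.powerStep_pow hy]
  rw [← Finset.sum_div, div_eq_one_iff_eq (h.form_pos hy).ne', form_eq_sum]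
  exact Finset.sum_congr rfl fun i _ => mul_comm _ _

/-- Stopping and continuing constantly agrees with iterating the step, so the stopping rule can be
ignored. -/
lemma powerStep_eq_self (h : A.IsPosEigenpair lam x) (hy : ∀ i, 0 < y i)
    (hres : A.residual y = 0) : A.powerStep y = y := by
  funext i
  have hi := congrFun hres i
  simp only [residual, Pi.zero_apply] at hi
  refine (pow_left_inj₀ ((h.powerStep_mem hy).1 i).le (hy i).le (n := d + 2) (by omega)).mp ?_
  rw [h.powerStep_pow hy, div_eq_iff (h.form_pos hy).ne']
  linear_combination (-y i) * hi

lemma powerStep_eigen (h : A.IsPosEigenpair lam x) : A.powerStep x = x := by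
  refine h.powerStep_eq_self h.pos (funext fun i => ?_)
  simp [residual, h.eigen.1 i, h.eigen.form_eq]

lemma powerSeq_mem (h : A.IsPosEigenpair lam x) (hy : y ∈ posSphere (d + 2) n) (k : ℕ) :
    A.powerSeq y k ∈ posSphere (d + 2) n := by
  induction k with
  | zero => exact hy
  | succ k ih =>
    rw [powerSeq]
    split_ifs
    · exact ih
    · exact h.powerStep_mem ih.1

lemma powerSeq_succ (h : A.IsPosEigenpair lam x) (hy : y ∈ posSphere (d + 2) n) (k : ℕ) :
    A.powerSeq y (k + 1) = A.powerStep (A.powerSeq y k) := by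
  rw [powerSeq]
  split_ifs with hres
  · exact (h.powerStep_eq_self (h.powerSeq_mem hy k).1 hres).symm
  · rfl

lemma log_powerStep (h : A.IsPosEigenpair lam x) (hy : ∀ i, 0 < y i) (i : Fin n) :
    ((d + 2 : ℕ) : ℝ) * Real.log (A.powerStep y i)
      = Real.log (A.contractVec y i) + Real.log (y i) - Real.log (A.form y) := by
  rw [← Real.log_pow, h.powerStep_pow hy, Real.log_div, Real.log_mul]
  · exact (h.contractVec_pos hy i).ne'
  · exact (hy i).ne'
  · exact (mul_pos (h.contractVec_pos hy i) (hy i)).ne'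
  · exact (h.form_pos hy).ne'

/-- Jensen's inequality for each slice, weighted by x_i/λ and summed over i. After exchanging the
sums, symmetry of A x^(m-2) and the eigenvalue equation collapse the left side to (m-1) Σ w_j
log(y_j/x_j). -/
lemma sum_log_contractVec (h : A.IsPosEigenpair lam x) (hy : ∀ i, 0 < y i) :
    ((d + 1 : ℕ) : ℝ) * ∑ i, x i ^ (d + 2) * Real.log (y i) + Real.log lam
      ≤ ∑ i, x i ^ (d + 2) * Real.log (A.contractVec y i) := by
  have hl := h.lam_pos.ne'
  have hi : ∀ i ∈ (Finset.univ : Finset (Fin n)),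
      ∑ j, ((d + 1 : ℕ) : ℝ) * lam⁻¹ * (Real.log (y j / x j) * x j * (A.contractMat x j i * x i))
      ≤ x i ^ (d + 2) * Real.log (A.contractVec y i) - x i ^ (d + 2) * Real.log lam
        - ((d + 1 : ℕ) : ℝ) * (x i ^ (d + 2) * Real.log (x i)) := by
    intro i _
    have h1 := (h.nonneg.slice i).jensen_log h.pos hy (h.contractVec_pos h.pos i)
    rw [(h.symm.slice i).sum_weighted x (fun j => Real.log (y j / x j))] at h1
    simp only [← contractVec_eq_form_slice, ← contractMat_eq_contractVec_slice, h.eigen.1] at h1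
    have hp : lam * x i ^ (d + 1) ≠ 0 := (mul_pos h.lam_pos (pow_pos (h.pos i) _)).ne'
    rw [Real.log_div (h.contractVec_pos hy i).ne' hp,
      Real.log_mul hl (pow_pos (h.pos i) _).ne', Real.log_pow] at h1
    have h2 := mul_le_mul_of_nonneg_left h1 (mul_pos (inv_pos.mpr h.lam_pos) (h.pos i)).le
    refine (le_of_eq ?_).trans (h2.trans (le_of_eq ?_))
    · rw [Finset.mul_sum, Finset.mul_sum]
      refine Finset.sum_congr rfl fun j _ => ?_
      rw [h.symm.contractMat_comm x j i]
      ring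
    · field_simp
      ring
  have hs := Finset.sum_le_sum hi
  rw [Finset.sum_comm] at hs
  have hj : ∀ j, ∑ i, ((d + 1 : ℕ) : ℝ) * lam⁻¹ *
      (Real.log (y j / x j) * x j * (A.contractMat x j i * x i))
      = ((d + 1 : ℕ) : ℝ) * (x j ^ (d + 2) * Real.log (y j))
        - ((d + 1 : ℕ) : ℝ) * (x j ^ (d + 2) * Real.log (x j)) := by
    intro j
    rw [← Finset.mul_sum, ← Finset.mul_sum, ← contractVec_eq_sum, h.eigen.1,
      Real.log_div (hy j).ne' (h.pos j).ne']
    field_simp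
    ring
  simp only [hj, Finset.sum_sub_distrib, ← Finset.mul_sum, ← Finset.sum_mul] at hs
  rw [h.eigen.2, one_mul] at hs
  linarith

/-- The weighted geometric mean increases along the iteration. -/
lemma sum_log_powerStep (h : A.IsPosEigenpair lam x) (hy : ∀ i, 0 < y i) :
    ((d + 2 : ℕ) : ℝ) * ∑ i, x i ^ (d + 2) * Real.log (y i)
        + (Real.log lam - Real.log (A.form y))
      ≤ ((d + 2 : ℕ) : ℝ) * ∑ i, x i ^ (d + 2) * Real.log (A.powerStep y i) := by
  have h1 := h.sum_log_contractVec hy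
  have h2 : ((d + 2 : ℕ) : ℝ) * ∑ i, x i ^ (d + 2) * Real.log (A.powerStep y i)
      = ∑ i, x i ^ (d + 2) * Real.log (A.contractVec y i)
        + ∑ i, x i ^ (d + 2) * Real.log (y i) - Real.log (A.form y) := by
    have h3 : Real.log (A.form y) = ∑ i, x i ^ (d + 2) * Real.log (A.form y) := by
      rw [← Finset.sum_mul, h.eigen.2, one_mul]
    rw [h3, Finset.mul_sum, ← Finset.sum_add_distrib, ← Finset.sum_sub_distrib]
    refine Finset.sum_congr rfl fun i _ => ?_
    rw [mul_left_comm, h.log_powerStep hy]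
    ring
  rw [h2]
  push_cast at h1 ⊢
  linarith

/-- The Lyapunov function V increases and is bounded, so its increments vanish and A x_k^m → λ. The
orbit stays in a compact set of positive vectors, where every cluster point has form value λ and is
therefore x. -/
lemma tendsto_powerSeq (h : A.IsPosEigenpair lam x) (hy : y ∈ posSphere (d + 2) n) :
    Tendsto (A.powerSeq y) atTop (𝓝 x) := by
  set V : (Fin n → ℝ) → ℝ := fun z => ∑ i, x i ^ (d + 2) * Real.log (z i) with hV
  have hmem := h.powerSeq_mem hy
  have hterm : ∀ k i, x i ^ (d + 2) * Real.log (A.powerSeq y k i) ≤ 0 := fun k i =>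
    mul_nonpos_of_nonneg_of_nonpos (pow_nonneg (h.pos i).le _)
      (Real.log_nonpos ((hmem k).1 i).le (le_one_of_mem_posSphere (hmem k) i))
  have hVle : ∀ k, V (A.powerSeq y k) ≤ 0 := fun k => Finset.sum_nonpos fun i _ => hterm k i
  have hm : (0 : ℝ) < ((d + 2 : ℕ) : ℝ) := by positivity
  have hgap : ∀ k, 0 ≤ Real.log lam - Real.log (A.form (A.powerSeq y k)) := fun k =>
    sub_nonneg.mpr (Real.log_le_log (h.form_pos (hmem k).1) (h.form_le (hmem k)))
  have hstep : ∀ k, ((d + 2 : ℕ) : ℝ) * V (A.powerSeq y k)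
      + (Real.log lam - Real.log (A.form (A.powerSeq y k)))
      ≤ ((d + 2 : ℕ) : ℝ) * V (A.powerSeq y (k + 1)) := fun k => by
    rw [h.powerSeq_succ hy]
    exact h.sum_log_powerStep (hmem k).1
  have hmono : Monotone fun k => V (A.powerSeq y k) := monotone_nat_of_le_succ fun k =>
    le_of_mul_le_mul_left (by linarith [hstep k, hgap k]) hm
  have hVlim := tendsto_atTop_ciSup hmono ⟨0, by rintro _ ⟨k, rfl⟩; exact hVle k⟩
  have hdiff := (((hVlim.comp (tendsto_add_atTop_nat 1)).sub hVlim).const_mul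
    ((d + 2 : ℕ) : ℝ))
  rw [sub_self, mul_zero] at hdiff
  have hlog : Tendsto (fun k => Real.log lam - Real.log (A.form (A.powerSeq y k))) atTop (𝓝 0) :=
    squeeze_zero hgap (fun k => by
      have := hstep k
      simp only [Function.comp_apply]
      linarith) hdiff
  have hform : Tendsto (fun k => A.form (A.powerSeq y k)) atTop (𝓝 lam) := by
    have h1 := (hlog.const_sub (Real.log lam)).rexp
    simp only [sub_sub_cancel, sub_zero, Real.exp_log h.lam_pos] at h1
    exact h1.congr fun k => Real.exp_log (h.form_pos (hmem k).1)
  -- All terms of V are nonpositive, so each single term is at least V(x_k) ≥ V(x_0), which bounds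
  -- every coordinate away from 0.
  have hlow : ∀ k i, Real.exp (V y / x i ^ (d + 2)) ≤ A.powerSeq y k i := by
    intro k i
    rw [← Real.le_log_iff_exp_le ((hmem k).1 i), div_le_iff₀' (pow_pos (h.pos i) _)]
    refine (hmono (Nat.zero_le k)).trans ?_
    have := Finset.single_le_sum (f := fun i => -(x i ^ (d + 2) * Real.log (A.powerSeq y k i)))
      (fun j _ => neg_nonneg.mpr (hterm k j)) (Finset.mem_univ i)
    rw [Finset.sum_neg_distrib] at this
    exact neg_le_neg_iff.mp this
  refine ((isCompact_Icc (a := fun i => Real.exp (V y / x i ^ (d + 2))) (b := 1)).inter_right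
    (isClosed_eq (f := fun z : Fin n → ℝ => ∑ i, z i ^ (d + 2)) (g := fun _ => 1)
      (by fun_prop) continuous_const)).tendsto_nhds_of_unique_mapClusterPt
    (Eventually.of_forall fun k =>
      ⟨⟨hlow k, le_one_of_mem_posSphere (hmem k)⟩, (hmem k).2⟩) ?_
  rintro z ⟨⟨hz0, -⟩, hz1⟩ hcl
  have hz : z ∈ posSphere (d + 2) n := ⟨fun i => (Real.exp_pos _).trans_le (hz0 i), hz1⟩
  refine eq_of_form_eq h.symm h.nonneg h.irr h.eigen h.pos hz ?_
  have hcl' := hcl.continuousAt_comp (f := A.form) A.continuous_form.continuousAt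
  exact eq_of_nhds_neBot (ClusterPt.mono hcl' hform)

end IsPosEigenpair

end PowerLike.Tensor

/-! ### The weighted norm and the local linear rate of the iterates. -/

namespace PowerLike

section WeightedNorm

variable {e n : ℕ} {x : Fin n → ℝ}

lemma weightedNorm_eq_sqrt (e : ℕ) (x p : Fin n → ℝ) :
    weightedNorm e x p = Real.sqrt (∑ i, x i ^ e * p i ^ 2) := by
  rw [weightedNorm]
  congr 1
  refine Finset.sum_congr rfl fun i _ => ?_
  rw [Matrix.mulVec_diagonal]
  ring

lemma weightedNorm_nonneg (e : ℕ) (x p : Fin n → ℝ) : 0 ≤ weightedNorm e x p :=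
  Real.sqrt_nonneg _

lemma weightedNorm_sq (hx : ∀ i, 0 < x i) (p : Fin n → ℝ) :
    weightedNorm e x p ^ 2 = ∑ i, x i ^ e * p i ^ 2 := by
  rw [weightedNorm_eq_sqrt, Real.sq_sqrt]
  exact Finset.sum_nonneg fun i _ => mul_nonneg (pow_nonneg (hx i).le _) (sq_nonneg _)

lemma weightedNorm_add_le (hx : ∀ i, 0 < x i) (p q : Fin n → ℝ) :
    weightedNorm e x (p + q) ≤ weightedNorm e x p + weightedNorm e x q := by
  have hE : ∀ p : Fin n → ℝ, weightedNorm e x p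
      = ‖(WithLp.toLp 2 fun i => Real.sqrt (x i ^ e) * p i : EuclideanSpace ℝ (Fin n))‖ := by
    intro p
    rw [weightedNorm_eq_sqrt, EuclideanSpace.norm_eq]
    congr 1
    refine Finset.sum_congr rfl fun i _ => ?_
    rw [Real.norm_eq_abs, sq_abs, mul_pow, Real.sq_sqrt (pow_nonneg (hx i).le _)]
  rw [hE, hE, hE]
  refine le_of_eq_of_le ?_ (norm_add_le _ _)
  congr 1
  ext i
  simp [mul_add]

lemma weightedNorm_sub_comm (e : ℕ) (x p q : Fin n → ℝ) :
    weightedNorm e x (p - q) = weightedNorm e x (q - p) := by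
  rw [weightedNorm_eq_sqrt, weightedNorm_eq_sqrt]
  congr 1
  exact Finset.sum_congr rfl fun i _ => by simp only [Pi.sub_apply]; ring

lemma exists_weightedNorm_le (e : ℕ) (hx : ∀ i, 0 < x i) :
    ∃ C > 0, ∀ p, weightedNorm e x p ≤ C * ‖p‖ := by
  have hS : 0 ≤ ∑ i, x i ^ e := Finset.sum_nonneg fun i _ => pow_nonneg (hx i).le _
  refine ⟨Real.sqrt (∑ i, x i ^ e + 1), Real.sqrt_pos.mpr (by linarith), fun p => ?_⟩
  rw [weightedNorm_eq_sqrt]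
  refine Real.sqrt_le_iff.mpr ⟨by positivity, ?_⟩
  rw [mul_pow, Real.sq_sqrt (by linarith), add_mul, Finset.sum_mul]
  have : ∑ i, x i ^ e * p i ^ 2 ≤ ∑ i, x i ^ e * ‖p‖ ^ 2 := by
    refine Finset.sum_le_sum fun i _ => mul_le_mul_of_nonneg_left ?_ (pow_nonneg (hx i).le _)
    rw [sq_le_sq, abs_norm]
    exact norm_le_pi_norm p i
  nlinarith [sq_nonneg ‖p‖]

lemma exists_pos_le (hx : ∀ i, 0 < x i) : ∃ ε > 0, ∀ i, ε ≤ x i := by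
  rcases isEmpty_or_nonempty (Fin n) with hn | hn
  · exact ⟨1, one_pos, fun i => (hn.false i).elim⟩
  · obtain ⟨i, hi⟩ := Finite.exists_min x
    exact ⟨x i, hx i, hi⟩

lemma exists_sum_sq_le_weightedNorm (e : ℕ) (hx : ∀ i, 0 < x i) :
    ∃ C > 0, ∀ p : Fin n → ℝ, ∑ i, p i ^ 2 ≤ C * weightedNorm e x p ^ 2 := by
  obtain ⟨ε, hε, hle⟩ := exists_pos_le hx
  refine ⟨(ε ^ e)⁻¹, by positivity, fun p => ?_⟩
  rw [weightedNorm_sq hx, inv_mul_eq_div, le_div_iff₀' (by positivity), Finset.mul_sum]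
  exact Finset.sum_le_sum fun i _ =>
    mul_le_mul_of_nonneg_right (pow_le_pow_left₀ hε.le (hle i) _) (sq_nonneg _)

lemma exists_norm_le_weightedNorm (e : ℕ) (hx : ∀ i, 0 < x i) :
    ∃ C > 0, ∀ p : Fin n → ℝ, ‖p‖ ≤ C * weightedNorm e x p := by
  obtain ⟨C, hC, h⟩ := exists_sum_sq_le_weightedNorm e hx
  refine ⟨Real.sqrt C, Real.sqrt_pos.mpr hC, fun p => ?_⟩
  have h0 := mul_nonneg (Real.sqrt_nonneg C) (weightedNorm_nonneg e x p)
  refine (pi_norm_le_iff_of_nonneg h0).mpr fun i => ?_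
  refine abs_le_of_sq_le_sq ?_ h0
  rw [mul_pow, Real.sq_sqrt hC.le]
  exact (Finset.single_le_sum (f := fun i => p i ^ 2) (fun _ _ => sq_nonneg _)
    (Finset.mem_univ i)).trans (h p)

end WeightedNorm

namespace Tensor.IsPosEigenpair

variable {d n : ℕ} {A : Tensor (d + 2) n} {x y : Fin n → ℝ} {lam : ℝ}

/-- In relative coordinates v/x the derivative is the centred kernel: the quotient by A x^m
contributes the rank-one mean term, and the factor y_i the identity part of the kernel. -/
lemma exists_hasFDerivAt_powerStep (h : A.IsPosEigenpair lam x) :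
    ∃ L : (Fin n → ℝ) →L[ℝ] (Fin n → ℝ), HasFDerivAt A.powerStep L x ∧ ∀ v i,
      L v i = x i * (∑ j, A.kernel x lam i j * (v j / x j)
        - ∑ j, x j ^ (d + 2) * (v j / x j)) := by
  have hf := h.symm.hasFDerivAt_form x
  have hfx := h.eigen.form_eq
  have hl := h.lam_pos.ne'
  have hx := fun i => (h.pos i).ne'
  have hq : ∀ i, HasFDerivAt (fun z => A.contractVec z i * z i * (A.form z)⁻¹) _ x := fun i =>
    (((h.symm.slice i).hasFDerivAt_form x).mul (hasFDerivAt_apply (𝕜 := ℝ) i x)).mul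
      ((hasDerivAt_inv (by rw [hfx]; exact hl)).comp_hasFDerivAt x hf)
  have hG : ∀ i, HasFDerivAt (fun z => A.powerStep z i) _ x := fun i => by
    have h1 := (hq i).rpow_const (p := 1 / ((d + 2 : ℕ) : ℝ)) (Or.inl (mul_pos
      (mul_pos (h.contractVec_pos h.pos i) (h.pos i)) (inv_pos.mpr (h.form_pos h.pos))).ne')
    simp only [← div_eq_mul_inv] at h1
    exact h1
  refine ⟨_, hasFDerivAt_pi.mpr hG, fun v i => ?_⟩
  have hpow : (lam * (x i ^ (d + 1) * x i) / lam) ^ (1 / ((d + 2 : ℕ) : ℝ) - 1)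
      = (x i ^ (d + 1))⁻¹ := by
    have : lam * (x i ^ (d + 1) * x i) / lam = x i ^ (d + 2) := by
      field_simp
      ring
    rw [this, ← Real.rpow_natCast, ← Real.rpow_mul (h.pos i).le, ← Real.rpow_natCast,
      ← Real.rpow_neg (h.pos i).le]
    congr 1
    push_cast
    field_simp
    ring
  have hker : ∑ j, A.kernel x lam i j * (v j / x j) = ((d + 2 : ℕ) : ℝ)⁻¹ * (v i / x i
      + ((d + 1 : ℕ) : ℝ) * ((∑ j, A.contractMat x i j * v j) / (lam * x i ^ (d + 1)))) := by
    simp only [kernel, mul_assoc, ← Finset.mul_sum]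
    congr 1
    simp only [add_mul, Finset.sum_add_distrib, mul_assoc, ← Finset.mul_sum, Finset.sum_div]
    congr 1
    · simp
    · congr 1
      refine Finset.sum_congr rfl fun j _ => ?_
      have := hx j
      field_simp
  have hw : ∀ j, x j ^ (d + 2) * (v j / x j) = x j ^ (d + 1) * v j := fun j => by
    have := hx j
    field_simp
    ring
  simp only [hker, hw]
  simp only [ContinuousLinearMap.pi_apply, smul_apply, add_apply, sum_apply,
    ContinuousLinearMap.proj_apply, smul_eq_mul, Pi.mul_apply,
    ← contractMat_eq_contractVec_slice, ← contractVec_eq_form_slice, h.eigen.1, hfx, mul_assoc,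
    ← Finset.mul_sum]
  rw [hpow]
  have := hx i
  field_simp
  ring

lemma exists_powerStep_contraction (h : A.IsPosEigenpair lam x) :
    ∃ δ ∈ Set.Ioo (0 : ℝ) 1, ∀ᶠ z in 𝓝 x,
      weightedNorm d x (A.powerStep z - x) ≤ δ * weightedNorm d x (z - x) := by
  obtain ⟨L, hL, hLv⟩ := h.exists_hasFDerivAt_powerStep
  obtain ⟨δ, hδ, hK⟩ :=
    exists_kernel_contraction h.symm h.nonneg h.irr h.eigen h.pos h.lam_pos
  obtain ⟨C, hC, hCle⟩ := exists_weightedNorm_le d h.pos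
  obtain ⟨c, hc, hcle⟩ := exists_norm_le_weightedNorm d h.pos
  set σ := Real.sqrt δ with hσ
  have hσ0 : 0 < σ := Real.sqrt_pos.mpr hδ.1
  have hσ1 : σ < 1 := (Real.sqrt_lt' one_pos).mpr (by simpa using hδ.2)
  have hLle : ∀ v, weightedNorm d x (L v) ≤ σ * weightedNorm d x v := by
    intro v
    refine abs_le_of_sq_le_sq' ?_ (mul_nonneg hσ0.le (weightedNorm_nonneg _ _ _)) |>.2
    rw [mul_pow, hσ, Real.sq_sqrt hδ.1.le, weightedNorm_sq h.pos, weightedNorm_sq h.pos]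
    refine le_of_eq_of_le ?_ ((hK fun j => v j / x j).trans_eq ?_)
    · refine Finset.sum_congr rfl fun i _ => ?_
      rw [hLv]; ring
    · congr 1
      refine Finset.sum_congr rfl fun i _ => ?_
      have := (h.pos i).ne'
      field_simp
      ring
  -- Half of the slack 1 - σ is spent on the remainder; C and c convert between the sup norm and the
  -- weighted norm.
  have hη : 0 < (1 - σ) / 2 / (C * c) := div_pos (by linarith) (mul_pos hC hc)
  refine ⟨(1 + σ) / 2, ⟨by linarith, by linarith⟩, ?_⟩
  filter_upwards [hL.isLittleO.def hη] with z hz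
  rw [h.powerStep_eigen] at hz
  have hsplit : A.powerStep z - x = L (z - x) + (A.powerStep z - x - L (z - x)) := by abel
  rw [hsplit]
  refine (weightedNorm_add_le h.pos _ _).trans ?_
  have h1 : weightedNorm d x (A.powerStep z - x - L (z - x))
      ≤ (1 - σ) / 2 * weightedNorm d x (z - x) := by
    calc _ ≤ C * ‖A.powerStep z - x - L (z - x)‖ := hCle _
      _ ≤ C * ((1 - σ) / 2 / (C * c) * (c * weightedNorm d x (z - x))) := by
          refine mul_le_mul_of_nonneg_left (hz.trans ?_) hC.le
          exact mul_le_mul_of_nonneg_left (hcle _) hη.le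
      _ = _ := by field_simp
  have h2 := hLle (z - x)
  linarith

lemma qLinear_weightedNorm (h : A.IsPosEigenpair lam x) (hy : y ∈ posSphere (d + 2) n) :
    QLinear fun k => weightedNorm d x (A.powerSeq y k - x) := by
  have hlim := h.tendsto_powerSeq hy
  obtain ⟨C, hC, hCle⟩ := exists_weightedNorm_le d h.pos
  obtain ⟨δ, hδ, hev⟩ := h.exists_powerStep_contraction
  refine ⟨?_, δ, hδ, ?_⟩
  · have h1 := (tendsto_iff_norm_sub_tendsto_zero.mp hlim).const_mul C
    rw [mul_zero] at h1
    exact squeeze_zero (fun k => weightedNorm_nonneg _ _ _) (fun k => hCle _) h1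
  · filter_upwards [hlim.eventually hev] with k hk
    rwa [h.powerSeq_succ hy]

end Tensor.IsPosEigenpair
end PowerLike

/-! ### Linear rate of the eigenvalue estimates. -/

namespace PowerLike

lemma pow_sub_pow_sq_le {a b : ℝ} (ha : 0 < a) (hb : 0 < b) (ha1 : a ≤ 1) (hb1 : b ≤ 1) (m : ℕ) :
    (a ^ m - b ^ m) ^ 2 ≤ (m : ℝ) ^ 2 * (a - b) ^ 2 := by
  rw [← geom_sum₂_mul, mul_pow]
  refine mul_le_mul_of_nonneg_right (pow_le_pow_left₀ (Finset.sum_nonneg fun _ _ => by positivity)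
    ?_ 2) (sq_nonneg _)
  refine (Finset.sum_le_card_nsmul _ _ 1 fun i _ => ?_).trans (by simp)
  exact mul_le_one₀ (pow_le_one₀ ha.le ha1) (by positivity) (pow_le_one₀ hb.le hb1)

lemma le_pow_sub_pow_sq {a b κ : ℝ} (ha : 0 < a) (hκ : 0 < κ) (hb : κ ≤ b) (m : ℕ) :
    (κ ^ m) ^ 2 * (a - b) ^ 2 ≤ (a ^ (m + 1) - b ^ (m + 1)) ^ 2 := by
  have hb0 : 0 < b := hκ.trans_le hb
  rw [← geom_sum₂_mul, mul_pow]
  refine mul_le_mul_of_nonneg_right (pow_le_pow_left₀ (by positivity) ?_ 2) (sq_nonneg _)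
  refine (pow_le_pow_left₀ hκ.le hb m).trans ?_
  have := Finset.single_le_sum (f := fun i => a ^ i * b ^ (m + 1 - 1 - i))
    (fun i _ => by positivity) (Finset.mem_range.mpr (Nat.succ_pos m))
  simpa using this

/-- A pointwise lower bound for the integrand of the Kullback–Leibler divergence. -/
lemma le_mul_log_div {a b : ℝ} (ha : 0 < a) (hb : 0 < b) (ha1 : a ≤ 1) (hb1 : b ≤ 1) :
    a - b + (a - b) ^ 2 / 4 ≤ a * Real.log (a / b) := by
  -- With square roots s, t of a, b, the bound log u ≤ u - 1 gives a log(a/b) ≥ s² - t² + (s - t)²,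
  -- a Hellinger-type bound.
  obtain ⟨s, hs, rfl⟩ : ∃ s, 0 < s ∧ s ^ 2 = a := ⟨√a, Real.sqrt_pos.mpr ha, Real.sq_sqrt ha.le⟩
  obtain ⟨t, ht, rfl⟩ : ∃ t, 0 < t ∧ t ^ 2 = b := ⟨√b, Real.sqrt_pos.mpr hb, Real.sq_sqrt hb.le⟩
  have hs1 : s ≤ 1 := (pow_le_one_iff_of_nonneg hs.le two_ne_zero).mp ha1
  have ht1 : t ≤ 1 := (pow_le_one_iff_of_nonneg ht.le two_ne_zero).mp hb1
  have h1 := Real.log_le_sub_one_of_pos (div_pos ht hs)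
  have h2 : Real.log (s ^ 2 / t ^ 2) = -(2 * Real.log (t / s)) := by
    rw [← div_pow, Real.log_pow, ← inv_div t s, Real.log_inv]
    push_cast; ring
  rw [h2]
  have h3 : s ^ 2 * (t / s) = s * t := by field_simp
  have h4 := mul_le_mul_of_nonneg_left h1 (sq_nonneg s)
  have h5 : (s ^ 2 - t ^ 2) ^ 2 / 4 ≤ (s - t) ^ 2 := by
    have h6 : (s + t) ^ 2 ≤ 2 ^ 2 := pow_le_pow_left₀ (by positivity) (by linarith) 2
    have h7 : (s ^ 2 - t ^ 2) ^ 2 = (s - t) ^ 2 * (s + t) ^ 2 := by ring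
    rw [h7]
    nlinarith [sq_nonneg (s - t)]
  linarith

namespace Tensor.IsPosEigenpair

variable {d n : ℕ} {A : Tensor (d + 2) n} {x y : Fin n → ℝ} {lam : ℝ}

/-- Quantitative monotonicity of the eigenvalue estimates. -/
lemma form_powerStep_sub (h : A.IsPosEigenpair lam x) (hy : y ∈ posSphere (d + 2) n) :
    A.form y * (∑ i, (A.powerStep y i ^ (d + 2) - y i ^ (d + 2)) ^ 2 / 4)
      ≤ A.form (A.powerStep y) - A.form y := by
  have hf := h.form_pos hy.1
  have hz := h.powerStep_mem hy.1
  set z := A.powerStep y with hzdef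
  have hJ := h.nonneg.jensen_log hy.1 hz.1 hf
  rw [h.symm.sum_weighted y fun i => Real.log (z i / y i)] at hJ
  have hle : ∀ {u : Fin n → ℝ}, u ∈ posSphere (d + 2) n → ∀ i, u i ^ (d + 2) ≤ 1 :=
    fun hu i => pow_le_one₀ (hu.1 i).le (le_one_of_mem_posSphere hu i)
  have hkl : ∑ i, (z i ^ (d + 2) - y i ^ (d + 2)) ^ 2 / 4
      ≤ ∑ i, z i ^ (d + 2) * Real.log (z i ^ (d + 2) / y i ^ (d + 2)) := by
    have h1 := Finset.sum_le_sum fun i (_ : i ∈ Finset.univ) => le_mul_log_div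
      (pow_pos (hz.1 i) (d + 2)) (pow_pos (hy.1 i) (d + 2)) (hle hz i) (hle hy i)
    rw [Finset.sum_add_distrib, Finset.sum_sub_distrib, hz.2, hy.2] at h1
    linarith
  -- Since z_i^m = y_i (A y^(m-1))_i / A y^m, the Jensen average is A y^m times the divergence of
  -- z^[m] from y^[m].
  have heq : ((d + 1 + 1 : ℕ) : ℝ) * ∑ i, Real.log (z i / y i) * (y i * A.contractVec y i)
      = A.form y * ∑ i, z i ^ (d + 2) * Real.log (z i ^ (d + 2) / y i ^ (d + 2)) := by
    rw [Finset.mul_sum, Finset.mul_sum]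
    refine Finset.sum_congr rfl fun i _ => ?_
    rw [← div_pow, Real.log_pow, hzdef, h.powerStep_pow hy.1]
    field_simp
  rw [heq] at hJ
  have hlog := Real.log_le_sub_one_of_pos (div_pos (h.form_pos hz.1) hf)
  have h2 := mul_le_mul_of_nonneg_left hlog hf.le
  have h3 : A.form y * (A.form z / A.form y - 1) = A.form z - A.form y := by field_simp
  have h4 := mul_le_mul_of_nonneg_left hkl hf.le
  linarith

/-- Near the eigenvector the eigenvalue estimate is accurate to second order. -/
lemma sub_form_le (h : A.IsPosEigenpair lam x) (hy : y ∈ posSphere (d + 2) n) {κ : ℝ}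
    (hκ : 0 < κ) (hκy : ∀ i, κ ≤ y i) :
    lam - A.form y ≤ lam * (((d + 2 : ℕ) : ℝ) ^ 2 / κ ^ (d + 2)) * ∑ i, (y i - x i) ^ 2 := by
  have hf := h.form_pos hy.1
  have hx := h.mem_posSphere
  have hJ := h.nonneg.jensen_log h.pos hy.1 (h.form_pos h.pos)
  rw [sum_weighted_eigen h.symm h.eigen fun i => Real.log (y i / x i), h.eigen.form_eq] at hJ
  -- The divergence of x^[m] from y^[m] is bounded by the chi-square distance; the linear terms
  -- cancel on summing because both vectors are normalized.
  have hterm : ∀ i ∈ Finset.univ, y i ^ (d + 2) - x i ^ (d + 2)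
      - ((d + 2 : ℕ) : ℝ) ^ 2 / κ ^ (d + 2) * (y i - x i) ^ 2
      ≤ ((d + 2 : ℕ) : ℝ) * (Real.log (y i / x i) * x i ^ (d + 2)) := by
    intro i _
    have hxi := pow_pos (h.pos i) (d + 2)
    have hyi := pow_pos (hy.1 i) (d + 2)
    have h1 := Real.log_le_sub_one_of_pos (div_pos hxi hyi)
    rw [← inv_div (y i ^ (d + 2)), Real.log_inv, ← div_pow, Real.log_pow, div_pow, inv_div] at h1
    have h2 := mul_le_mul_of_nonneg_left h1 hxi.le
    have h3 : x i ^ (d + 2) * (x i ^ (d + 2) / y i ^ (d + 2) - 1)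
        = x i ^ (d + 2) - y i ^ (d + 2)
          + (y i ^ (d + 2) - x i ^ (d + 2)) ^ 2 / y i ^ (d + 2) := by
      field_simp
      ring
    have h4 : (y i ^ (d + 2) - x i ^ (d + 2)) ^ 2 / y i ^ (d + 2)
        ≤ ((d + 2 : ℕ) : ℝ) ^ 2 / κ ^ (d + 2) * (y i - x i) ^ 2 := by
      rw [div_mul_eq_mul_div]
      exact div_le_div₀ (by positivity) (pow_sub_pow_sq_le (hy.1 i) (h.pos i)
        (le_one_of_mem_posSphere hy i) (le_one_of_mem_posSphere hx i) _) (pow_pos hκ _)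
        (pow_le_pow_left₀ hκ.le (hκy i) _)
    linarith
  have hsum := Finset.sum_le_sum hterm
  rw [Finset.sum_sub_distrib, Finset.sum_sub_distrib, hx.2, hy.2, ← Finset.mul_sum,
    ← Finset.mul_sum] at hsum
  have h5 := mul_le_mul_of_nonneg_left hsum h.lam_pos.le
  have hlog := Real.log_le_sub_one_of_pos (div_pos hf h.lam_pos)
  have h6 := mul_le_mul_of_nonneg_left hlog h.lam_pos.le
  have h7 : lam * (A.form y / lam - 1) = A.form y - lam := by
    have := h.lam_pos.ne'
    field_simp
  linarith

/-- With g_k = λ - λ_k, it suffices that g_k ≤ M (g_k - g_{k+1}), which is g_{k+1} ≤ (1 - 1/M) g_k.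
The gap is O(‖x_k - x‖²), and the increment is at least a multiple of ‖x_{k+1} - x_k‖². -/
lemma qLinear_powerEig (h : A.IsPosEigenpair lam x) (hy : y ∈ posSphere (d + 2) n) :
    QLinear fun k => |A.powerEig y k - lam| := by
  have hlim := h.tendsto_powerSeq hy
  have hmem := h.powerSeq_mem hy
  have hx := h.mem_posSphere
  have hform : Tendsto (fun k => A.form (A.powerSeq y k)) atTop (𝓝 lam) := by
    have := A.continuous_form.continuousAt.tendsto.comp hlim
    rwa [h.eigen.form_eq] at this
  refine ⟨by simpa [powerEig] using (hform.sub_const lam).abs, ?_⟩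
  obtain ⟨-, δ, hδ, hN⟩ := h.qLinear_weightedNorm hy
  obtain ⟨ε, hε, hεx⟩ := exists_pos_le h.pos
  obtain ⟨C, hC, hCle⟩ := exists_sum_sq_le_weightedNorm d h.pos
  have hκ : 0 < ε / 2 := half_pos hε
  set κ := ε / 2 with hκdef
  have hκev : ∀ᶠ k in atTop, ∀ i, κ ≤ A.powerSeq y k i := by
    rw [eventually_all]
    intro i
    filter_upwards [(tendsto_pi_nhds.mp hlim i).eventually_const_lt
      (show κ < x i by have := hεx i; linarith)] with k hk using hk.le
  have hlam2 : ∀ᶠ k in atTop, lam / 2 < A.form (A.powerSeq y k) :=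
    hform.eventually_const_lt (half_lt_self h.lam_pos)
  set c₁ := lam * (((d + 2 : ℕ) : ℝ) ^ 2 / κ ^ (d + 2)) with hc₁
  have hc₁0 : 0 < c₁ := mul_pos h.lam_pos (by positivity)
  set c₂ := lam / 2 * ((κ ^ (d + 1)) ^ 2 / 4) with hc₂
  have hc₂0 : 0 < c₂ := mul_pos (half_pos h.lam_pos) (by positivity)
  have hδ1 : 0 < 1 - δ := sub_pos.mpr hδ.2
  -- The added 1 makes M > 1, so that 1 - 1/M lies in (0, 1).
  set M := c₁ * C / ((1 - δ) ^ 2 * c₂) + 1 with hM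
  have hM1 : 1 < M := by
    rw [hM]
    exact lt_add_of_pos_left _ (by positivity)
  have hM0 : 0 < M := one_pos.trans hM1
  refine ⟨1 - M⁻¹, ⟨sub_pos.mpr (inv_lt_one_of_one_lt₀ hM1), by
    have := inv_pos.mpr hM0; linarith⟩, ?_⟩
  filter_upwards [hN, hκev, hlam2] with k hNk hκk hlk
  have hz := hmem k
  have hz' := hmem (k + 1)
  have habs : ∀ j, |A.powerEig y j - lam| = lam - A.form (A.powerSeq y j) := fun j => by
    rw [powerEig, abs_sub_comm, abs_of_nonneg (sub_nonneg.mpr (h.form_le (hmem j)))]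
  rw [habs, habs]
  have hinc := h.form_powerStep_sub hz
  rw [← h.powerSeq_succ hy] at hinc
  have hup := (h.sub_form_le hz hκ hκk).trans
    (mul_le_mul_of_nonneg_left (hCle (A.powerSeq y k - x)) hc₁0.le)
  set z := A.powerSeq y k
  set z' := A.powerSeq y (k + 1)
  have hlow : c₂ * ∑ i, (z' i - z i) ^ 2 ≤ A.form z' - A.form z := by
    refine le_trans ?_ hinc
    rw [hc₂, mul_assoc]
    refine mul_le_mul hlk.le ?_ (by positivity) (h.form_pos hz.1).le
    rw [Finset.mul_sum]
    refine Finset.sum_le_sum fun i _ => ?_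
    have := le_pow_sub_pow_sq (hz'.1 i) hκ (hκk i) (d + 1)
    linarith
  -- Q-linear convergence makes the step length comparable to the error.
  have hdist : (1 - δ) * weightedNorm d x (z - x) ≤ weightedNorm d x (z' - z) := by
    have h1 := weightedNorm_add_le (e := d) h.pos (z - z') (z' - x)
    rw [sub_add_sub_cancel, weightedNorm_sub_comm d x z z'] at h1
    linarith
  have hdist2 : (1 - δ) ^ 2 * weightedNorm d x (z - x) ^ 2 ≤ ∑ i, (z' i - z i) ^ 2 := by
    rw [← mul_pow]
    refine (pow_le_pow_left₀ (mul_nonneg hδ1.le (weightedNorm_nonneg _ _ _)) hdist 2).trans ?_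
    rw [weightedNorm_sq h.pos]
    refine Finset.sum_le_sum fun i _ => ?_
    exact mul_le_of_le_one_left (sq_nonneg _)
      (pow_le_one₀ (h.pos i).le (le_one_of_mem_posSphere hx i))
  have hmain : lam - A.form z ≤ M * (A.form z' - A.form z) := by
    have h1 : (1 - δ) ^ 2 * c₂ * weightedNorm d x (z - x) ^ 2 ≤ A.form z' - A.form z := by
      refine le_trans ?_ hlow
      rw [mul_right_comm, mul_comm]
      exact mul_le_mul_of_nonneg_left hdist2 hc₂0.le
    have h0 : 0 ≤ A.form z' - A.form z := le_trans (by positivity) h1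
    have h2 : c₁ * (C * weightedNorm d x (z - x) ^ 2)
        ≤ c₁ * C / ((1 - δ) ^ 2 * c₂) * (A.form z' - A.form z) := by
      rw [div_mul_eq_mul_div, le_div_iff₀ (by positivity)]
      have := mul_le_mul_of_nonneg_left h1 (mul_pos hc₁0 hC).le
      linarith
    rw [hM, add_mul, one_mul]
    linarith
  have hfin := mul_le_mul_of_nonneg_left hmain (inv_pos.mpr hM0).le
  rw [inv_mul_cancel_left₀ hM0.ne'] at hfin
  linarith

end Tensor.IsPosEigenpair
end PowerLike
end

theorem mainTheorem1 (d n : ℕ) (A : PowerLike.Tensor (d + 2) n)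
    (hsymm : A.IsSymmetric) (hnonneg : A.IsNonneg) (hirr : A.IsIrreducible) (hA : A ≠ 0) :
    (∃! p : (Fin n → ℝ) × ℝ, A.IsPerronPair p.1 p.2) ∧
    ∀ (xbar : Fin n → ℝ) (lambar : ℝ), A.IsPerronPair xbar lambar →
      spectralRadius ℂ ((A.iterMat xbar lambar).map (algebraMap ℝ ℂ)) < 1 ∧
      ∀ x₀ ∈ PowerLike.posSphere (d + 2) n,
        PowerLike.QLinear
          (fun k => PowerLike.weightedNorm d xbar (A.powerSeq x₀ k - xbar)) ∧
        PowerLike.QLinear (fun k => |A.powerEig x₀ k - lambar|) := by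
  refine ⟨PowerLike.Tensor.existsUnique_perronPair A hsymm hnonneg hirr hA, ?_⟩
  rintro x lam ⟨-, he, hx⟩
  have hlam : 0 < lam := he.form_eq ▸ hnonneg.form_pos hA hx
  have h : A.IsPosEigenpair lam x := ⟨hsymm, hnonneg, hirr, he, hx, hlam⟩
  exact ⟨PowerLike.Tensor.spectralRadius_iterMat_lt_one hsymm hnonneg hirr he hx hlam,
    fun x₀ hx₀ => ⟨h.qLinear_weightedNorm hx₀, h.qLinear_powerEig hx₀⟩⟩
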